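/- **Setting.** Fix $0<\theta<1$, $p>1$, $s>0$, $a\ge 0$, $r>0$, $\eta\ge 0$, and put $\langle j\rangle=\max\{|j|,1\}$. Let $\mathtt w_s=\mathtt w^\infty_{p,s,a}$ be the space of $v\in\ell^2(\mathbb Z,\mathbb C)$ with $|v|_s=|v|_{p,s,a}:=\sup_j|v_j|\langle j\rangle^pe^{a|j|+s\langle j\rangle^\theta}<\infty$. Multi-indices $\alpha,\beta,\delta$ are finitely supported maps $\mathbb Z\to\mathbb N$, $|\alpha|=\sum_j\alpha_j$, $\pi(\alpha-\beta)=\sum_jj(\alpha_j-\beta_j)$. A Hamiltonian $H$ is *$\eta$-regular*, $H\in\mathcal H_{r,s,\eta}$, if $H(u)=\sum_{\alpha,\beta}H_{\alpha,\beta}u^\alpha\bar u^\beta$ with $H_{\alpha,\beta}=\overline{H_{\beta,\alpha}}$ and $H_{\alpha,\beta}=0$ for $|\alpha|\ne|\beta|$, if this series and its $\eta$-majorant $\underline H_\eta(u)=\sum_{\alpha,\beta}|H_{\alpha,\beta}|e^{\eta|\pi(\alpha-\beta)|}u^\alpha\bar u^\beta$ converge absolutely at every point of the closed ball $\{|u|_s\le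 r\}$, and if $$|H|_{r,s,\eta}:=\frac1r\sup_{|u|_s\le r}\big|X_{\underline H_\eta}(u)\big|_s<\infty,\qquad X_F^{(j)}=\mathrm i\,\partial_{\bar u_j}F .$$ Let $\mathcal O\subseteq\{\omega\in\mathbb R^{\mathbb Z}:\sup_j|\omega_j-j^2|\le\frac12\}$. A family $H=H(\omega)$, $\omega\in\mathcal O$, belongs to $\mathcal H^{\mathcal O}_{r,s,\eta}$ if every $H(\omega)$ is $\eta$-regular and both suprema in $$\|H\|_{r,s,\eta}=\|H\|^{\mu,\mathcal O}_{r,s,\eta}:=\sup_{\omega\in\mathcal O}|H(\omega)|_{r,s,\eta}+\mu\sup_{\omega\ne\omega'\in\mathcal O}\frac{|H(\omega)-H(\omega')|_{r,s,\eta}}{\sup_j|\omega_j-\omega'_j|}$$ are finite; here $\mu\ge 0$. Let $I=(I_j)_{j\in\mathbb Z}$ with $I_j\ge 0$, $\sqrt I=(\sqrt{I_j})_j\in\mathtt w_s$, $|\sqrt I|_s\le\kappa r$, $\kappa<1$. Write $|u|^2=(|u_j|^2)_j$. For $H\in\mathcal H_{r,s,\eta}$ let $$\mathtt H(u,w)=\sum_{m,\alpha,\beta}H_{m+\alpha,m+\beta}\,w^mu^\alpha\bar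 u^\beta ,$$ the sum being over multi-indices with $|\alpha|=|\beta|$ and $\alpha_j\beta_j=0$ for all $j$, so that $H(u)=\mathtt H(u,|u|^2)$, and where $w$ is in the space $\mathtt w^\infty_{2p,2s,2a}$. For $q\in\mathbb N$ and $|u|_s<r$ put $$\Pi^{2q-2}H(u)=\frac1{q!}D_w^q\mathtt H(u,I)\big[|u|^2-I,\dots,|u|^2-I\big],\qquad \Pi^{\ge 2q-2}H=H-\sum_{i=0}^{q-1}\Pi^{2i-2}H .$$ Finally let $c_{\kappa}=1/\ln(\kappa^{-2})$ if $\frac12<\kappa^2<1$ and $c_\kappa=2\kappa^2$ if $0<\kappa^2\le\frac12$. **Proposition (Bourgain's representation).** Let $H\in\mathcal H^{\mathcal O}_{r,s,\eta}$ and $q\ge 0$. Then $\Pi^{\ge 2q-2}H$ is (on $|u|_s<r$ the sum of the power series of) a family in $\mathcal H^{\mathcal O}_{r,s,\eta}$, and for every $\omega\in\mathcal O$ there are functions $\check H_\delta$, $|\delta|=q$, such that $$\Pi^{\ge 2q-2}H(u)=\sum_{|\delta|=q}(|u|^2-I)^\delta\,\check H_\delta(u)\qquad\text{for }|u|_s<r,$$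 with absolute convergence of the sum over $\delta$. Each $\check H_\delta$ is (real-)analytic in the open ball $\{|u|_s<r\}$ and is given there by a power series in $(u,\bar u)$ that converges totally on every ball $\{|u|_s\le\kappa_*r\}$, $0<\kappa_*<1$. Moreover, for every $\kappa_*$ with $\kappa\le\kappa_*<1$, $\kappa_*>0$, and every $\mu\ge 0$, $$\|\Pi^{\ge 2q-2}H\|_{\kappa_*r,s,\eta}\le\frac1{\kappa_*^2}\Big(\frac{\kappa^2+\kappa_*^2}{\kappa_*^2}\,c_{\kappa_*}\Big)^q\|H\|_{r,s,\eta}.$$ -/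

import Mathlib

open scoped ENNReal NNReal

noncomputable section

namespace NLSTorus

/-! ### The weighted sequence spaces -/

/-- `⟨j⟩ = max {|j|, 1}`. -/
def jap (j : ℤ) : ℝ := max |(j : ℝ)| 1

/-- The weight `⟨j⟩^p e^{a|j| + s⟨j⟩^θ}`. -/
def weight (θ p s a : ℝ) (j : ℤ) : ℝ :=
  jap j ^ p * Real.exp (a * |(j : ℝ)| + s * jap j ^ θ)

theorem weight_pos (θ p s a : ℝ) (j : ℤ) : 0 < weight θ p s a j := by
  have h : 0 < jap j := lt_of_lt_of_le one_pos (le_max_right _ _)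
  exact mul_pos (Real.rpow_pos_of_pos h _) (Real.exp_pos _)

/-- The weight of `(2p, 2s, 2a)` is the square of the weight of `(p, s, a)`. -/
theorem weight_two (θ p s a : ℝ) (j : ℤ) :
    weight θ (2 * p) (2 * s) (2 * a) j = weight θ p s a j ^ 2 := by
  have h : 0 ≤ jap j := le_trans zero_le_one (le_max_right _ _)
  unfold weight
  rw [mul_pow, ← Real.exp_nat_mul, ← Real.rpow_natCast, ← Real.rpow_mul h]
  congr 1
  · congr 1
    push_cast
    ring
  · congr 1
    push_cast
    ring

/-- The sequences in `ℓ²(ℂ)` with `sup_j |v_j| ⟨j⟩^p e^{a|j| + s⟨j⟩^θ} < ∞`. -/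
def wSub (θ p s a : ℝ) : Submodule ℂ (ℤ → ℂ) where
  carrier := {v | Summable (fun j => ‖v j‖ ^ 2) ∧
    BddAbove (Set.range fun j => ‖v j‖ * weight θ p s a j)}
  zero_mem' := by
    refine ⟨by simp, ⟨0, ?_⟩⟩
    rintro _ ⟨j, rfl⟩
    simp
  add_mem' := by
    rintro u v ⟨hu, ⟨A, hA⟩⟩ ⟨hv, ⟨B, hB⟩⟩
    refine ⟨?_, ⟨A + B, ?_⟩⟩
    · refine Summable.of_nonneg_of_le (fun j => by positivity) (fun j => ?_)
        ((hu.mul_left 2).add (hv.mul_left 2))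
      have h := norm_add_le (u j) (v j)
      have h0 := norm_nonneg (u j + v j)
      simp only [Pi.add_apply]
      nlinarith [sq_nonneg (‖u j‖ - ‖v j‖)]
    · rintro _ ⟨j, rfl⟩
      have h1 := hA ⟨j, rfl⟩
      have h2 := hB ⟨j, rfl⟩
      have h := mul_le_mul_of_nonneg_right (norm_add_le (u j) (v j)) (weight_pos θ p s a j).le
      simp only [Pi.add_apply] at *
      linarith
  smul_mem' := by
    rintro c v ⟨hv, ⟨B, hB⟩⟩
    refine ⟨?_, ⟨‖c‖ * B, ?_⟩⟩
    · simpa [mul_pow] using hv.mul_left (‖c‖ ^ 2)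
    · rintro _ ⟨j, rfl⟩
      have h2 := mul_le_mul_of_nonneg_left (hB ⟨j, rfl⟩) (norm_nonneg c)
      simpa [mul_assoc] using h2

/-- The space `w^∞_{p,s,a}` (a type of its own, so that it carries only the norm topology). -/
def W (θ p s a : ℝ) : Type := ↥(wSub θ p s a)

variable {θ p s a : ℝ}

instance : AddCommGroup (W θ p s a) := inferInstanceAs (AddCommGroup ↥(wSub θ p s a))

instance : Module ℂ (W θ p s a) := inferInstanceAs (Module ℂ ↥(wSub θ p s a))

/-- The underlying sequence of an element of `w^∞_{p,s,a}`. -/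
def W.seq (v : W θ p s a) : ℤ → ℂ := v.1

instance : CoeFun (W θ p s a) (fun _ => ℤ → ℂ) := ⟨W.seq⟩

theorem W.add_apply (u v : W θ p s a) (j : ℤ) : (u + v) j = u j + v j := rfl

theorem W.smul_apply (c : ℂ) (v : W θ p s a) (j : ℤ) : (c • v) j = c * v j := rfl

theorem W.zero_apply (j : ℤ) : (0 : W θ p s a) j = 0 := rfl

theorem W.bdd (v : W θ p s a) : BddAbove (Set.range fun j => ‖v j‖ * weight θ p s a j) := v.2.2

/-- `|v|_{p,s,a} = sup_j |v_j| ⟨j⟩^p e^{a|j| + s⟨j⟩^θ}`. -/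
instance : Norm (W θ p s a) := ⟨fun v => ⨆ j : ℤ, ‖v j‖ * weight θ p s a j⟩

theorem W.norm_def (v : W θ p s a) : ‖v‖ = ⨆ j : ℤ, ‖v j‖ * weight θ p s a j := rfl

theorem W.core : NormedSpace.Core ℂ (W θ p s a) where
  norm_nonneg v := Real.iSup_nonneg fun j =>
    mul_nonneg (norm_nonneg _) (weight_pos θ p s a j).le
  norm_smul c v := by
    rw [W.norm_def, W.norm_def, Real.mul_iSup_of_nonneg (norm_nonneg c)]
    congr 1
    funext j
    rw [W.smul_apply, norm_mul, mul_assoc]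
  norm_triangle u v := by
    refine ciSup_le fun j => ?_
    have h1 := le_ciSup u.bdd j
    have h2 := le_ciSup v.bdd j
    have h := mul_le_mul_of_nonneg_right (norm_add_le (u j) (v j)) (weight_pos θ p s a j).le
    rw [W.add_apply]
    rw [W.norm_def, W.norm_def]
    linarith
  norm_eq_zero_iff v := by
    constructor
    · intro h
      refine Subtype.ext (funext fun j => ?_)
      have h1 : ‖v j‖ * weight θ p s a j ≤ ‖v‖ := le_ciSup v.bdd j
      rw [h] at h1
      have h2 : ‖v j‖ ≤ 0 := by
        by_contra hc
        exact absurd (mul_pos (not_le.mp hc) (weight_pos θ p s a j)) (not_lt.mpr h1)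
      exact norm_le_zero_iff.mp h2
    · rintro rfl
      simp [W.norm_def, W.zero_apply]

instance : NormedAddCommGroup (W θ p s a) := NormedAddCommGroup.ofCore W.core

instance : NormedSpace ℂ (W θ p s a) := NormedSpace.ofCore W.core

/-- The sequence `|u|² = (|u_j|²)_j`, an element of `w^∞_{2p,2s,2a}`. -/
def absSq (u : W θ p s a) : W θ (2 * p) (2 * s) (2 * a) :=
  ⟨fun j => ((‖u j‖ ^ 2 : ℝ) : ℂ), by
    have hs : Summable (fun j => ‖u j‖ ^ 2) := u.2.1
    refine ⟨?_, ?_⟩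
    · have h := hs.mul_of_nonneg hs (fun j => by positivity) (fun j => by positivity)
      have h' := h.comp_injective (i := fun j : ℤ => (j, j))
        (fun x y hxy => (Prod.mk.inj hxy).1)
      refine h'.congr fun j => ?_
      simp only [Function.comp, Complex.norm_real, norm_pow, norm_norm]
      ring
    · obtain ⟨B, hB⟩ := u.bdd
      refine ⟨B ^ 2, ?_⟩
      rintro _ ⟨j, rfl⟩
      have h1 : ‖u j‖ * weight θ p s a j ≤ B := hB ⟨j, rfl⟩
      have h0 : 0 ≤ ‖u j‖ * weight θ p s a j :=
        mul_nonneg (norm_nonneg _) (weight_pos θ p s a j).le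
      have h2 := pow_le_pow_left₀ h0 h1 2
      simp only [Complex.norm_real, norm_pow, norm_norm, weight_two]
      rwa [mul_pow] at h2⟩

/-! ### Hamiltonians -/

/-- Multi-indices: finitely supported `α : ℤ → ℕ`; `|α|` is `Finsupp.degree α`. -/
abbrev MI : Type := ℤ →₀ ℕ

/-- The monomial `v^α = ∏_j v_j^{α_j}`. -/
def mpow (v : ℤ → ℂ) (α : MI) : ℂ := α.prod fun j n => v j ^ n

/-- The monomial `u^α ū^β`. -/
def mono (u : ℤ → ℂ) (α β : MI) : ℂ := mpow u α * mpow (fun j => (starRingEnd ℂ) (u j)) β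

/-- The momentum `π(α) = ∑_j j α_j`. -/
def momentum (α : MI) : ℤ := α.sum fun j n => j * (n : ℤ)

/-- A power series `∑ H_{α,β} u^α ū^β`, given by its coefficients. Since a function on a ball has at
most one such expansion, a Hamiltonian is identified with its coefficients. -/
abbrev Ser : Type := MI → MI → ℂ

/-- The value `H(u) = ∑_{α,β} H_{α,β} u^α ū^β`. -/
def Ser.eval (H : Ser) (u : ℤ → ℂ) : ℂ := ∑' x : MI × MI, H x.1 x.2 * mono u x.1 x.2

/-- The class `𝒜_r(w^∞_{p,s,a})`: series that converge absolutely at every point of the closed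
ball of radius `r`, satisfy the reality condition and conserve the mass. -/
structure IsMajorantAnalytic (θ p s a r : ℝ) (H : Ser) : Prop where
  summable : ∀ u : W θ p s a, ‖u‖ ≤ r →
    Summable fun x : MI × MI => ‖H x.1 x.2 * mono u x.1 x.2‖
  real : ∀ α β, H α β = (starRingEnd ℂ) (H β α)
  mass : ∀ α β, α.degree ≠ β.degree → H α β = 0

/-- The `η`-majorant: the coefficients are `|H_{α,β}| e^{η|π(α-β)|}`. -/
def Ser.majorant (η : ℝ) (H : Ser) : Ser := fun α β =>
  ((‖H α β‖ * Real.exp (η * |((momentum α - momentum β : ℤ) : ℝ)|) : ℝ) : ℂ)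

/-- The Hamiltonian vector field `X_H^{(j)} = i ∂_{ū_j} H`, where the power series is differentiated
term by term (on the boundary of the ball of convergence this is its continuous extension). -/
def Ser.vectorField (H : Ser) (u : ℤ → ℂ) (j : ℤ) : ℂ :=
  Complex.I * ∑' x : MI × MI, H x.1 x.2 * (x.2 j : ℂ) * mono u x.1 (x.2 - Finsupp.single j 1)

/-- The extended norm `sup_j |v_j| ⟨j⟩^p e^{a|j| + s⟨j⟩^θ} ∈ [0, ∞]` of any sequence. -/
def wNormE (θ p s a : ℝ) (v : ℤ → ℂ) : ℝ≥0∞ := ⨆ j : ℤ, ‖v j‖ₑ * ENNReal.ofReal (weight θ p s a j)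

/-- The seminorm `|H|_{r,s,η} = r⁻¹ sup_{|u|≤r} |X_{H̲_η}(u)|`, with values in `[0, ∞]`. -/
def hamNorm (θ p s a r η : ℝ) (H : Ser) : ℝ≥0∞ :=
  (⨆ (u : W θ p s a) (_ : ‖u‖ ≤ r), wNormE θ p s a ((H.majorant η).vectorField u)) /
    ENNReal.ofReal r

/-- The class `𝓗_{r,s,η}` of `η`-regular Hamiltonians. -/
structure IsRegular (θ p s a r η : ℝ) (H : Ser) : Prop where
  analytic : IsMajorantAnalytic θ p s a r H
  majorant_analytic : IsMajorantAnalytic θ p s a r (H.majorant η)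
  bounded : hamNorm θ p s a r η H < ∞

/-! ### Dependence on the frequency -/

/-- The hypercube `𝒬 = {ω ∈ ℝ^ℤ : sup_j |ω_j - j²| ≤ 1/2}`. -/
def freqCube : Set (ℤ → ℝ) := {ω | ∀ j : ℤ, |ω j - (j : ℝ) ^ 2| ≤ 1 / 2}

/-- `sup_{ω ∈ 𝒪} |H(ω)|_{r,s,η}`. -/
def supNorm (θ p s a r η : ℝ) (O : Set (ℤ → ℝ)) (H : (ℤ → ℝ) → Ser) : ℝ≥0∞ :=
  ⨆ ω ∈ O, hamNorm θ p s a r η (H ω)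

/-- The Lipschitz seminorm `sup_{ω ≠ ω'} |H(ω) - H(ω')|_{r,s,η} / |ω - ω'|_∞`. -/
def lipNorm (θ p s a r η : ℝ) (O : Set (ℤ → ℝ)) (H : (ℤ → ℝ) → Ser) : ℝ≥0∞ :=
  ⨆ (ω ∈ O) (ω' ∈ O) (_ : ω ≠ ω'),
    hamNorm θ p s a r η (H ω - H ω') / (⨆ j : ℤ, ‖ω j - ω' j‖ₑ)

/-- The weighted Lipschitz norm `‖H‖_{r,s,η}^{μ,𝒪}`. -/
def famNorm (θ p s a r η : ℝ) (μ : ℝ≥0) (O : Set (ℤ → ℝ)) (H : (ℤ → ℝ) → Ser) : ℝ≥0∞ :=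
  supNorm θ p s a r η O H + μ * lipNorm θ p s a r η O H

/-- The class `𝓗_{r,s,η}^𝒪` of Lipschitz families of `η`-regular Hamiltonians. Only the values on
`𝒪` of the family matter. -/
structure IsRegularFamily (θ p s a r η : ℝ) (O : Set (ℤ → ℝ)) (H : (ℤ → ℝ) → Ser) : Prop where
  regular : ∀ ω ∈ O, IsRegular θ p s a r η (H ω)
  sup_lt : supNorm θ p s a r η O H < ∞
  lip_lt : lipNorm θ p s a r η O H < ∞

/-! ### Projections at the torus -/

/-- The function `𝙷(u,w) = ∑ H_{m+α,m+β} w^m u^α ū^β` (sum over `m, α, β` with `|α| = |β|` and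
`α_j β_j = 0`): for each monomial `u^α ū^β` of `H`, the factor `|u|^{2m}` with
`m = min(α, β)` is replaced by `w^m`. -/
def Ser.lift (H : Ser) (u w : ℤ → ℂ) : ℂ :=
  ∑' x : MI × MI, H x.1 x.2 *
    (mpow w (x.1 ⊓ x.2) * mono u (x.1 - x.1 ⊓ x.2) (x.2 - x.1 ⊓ x.2))

/-- The projection `Π^{2i-2} H(u) = (1/i!) D_w^i 𝙷(u,I)[|u|² - I, …, |u|² - I]`, as a function of
`u`. -/
def proj (i : ℕ) (H : Ser) (I : W θ (2 * p) (2 * s) (2 * a)) (u : W θ p s a) : ℂ :=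
  (1 / (i.factorial : ℂ)) *
    iteratedFDeriv ℂ i (fun w : W θ (2 * p) (2 * s) (2 * a) => H.lift u w) I
      (fun _ => absSq u - I)

/-- The tail `Π^{≥2q-2} H = H - ∑_{i<q} Π^{2i-2} H`, as a function of `u`. -/
def tail (q : ℕ) (H : Ser) (I : W θ (2 * p) (2 * s) (2 * a)) (u : W θ p s a) : ℂ :=
  H.eval u - ∑ i ∈ Finset.range q, proj i H I u

/-- Total convergence of a power series on the closed ball of radius `ρ`: the suprema of the
monomials over the ball are summable. -/
def TotallyConvergent (θ p s a ρ : ℝ) (G : Ser) : Prop :=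
  ∃ M : MI × MI → ℝ, Summable M ∧
    ∀ (x : MI × MI) (u : W θ p s a), ‖u‖ ≤ ρ → ‖G x.1 x.2 * mono u x.1 x.2‖ ≤ M x

/-- The constant `c_κ`. -/
def cConst (κ : ℝ) : ℝ := if 1 / 2 < κ ^ 2 then 1 / Real.log (κ ^ (-2 : ℤ)) else 2 * κ ^ 2

end NLSTorus

end

/-!
A Hamiltonian is a sum of terms `H_{m+α,m+β} |u|^{2m} u^α ū^β` with `α`, `β` of disjoint supports,
and the projections at the torus `|u|² = I` only act on the powers `|u|^{2m}` of the actions. Hence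
everything reduces to the Taylor expansion at `I` of the monomials `X^m`, with bounds in weighted
`ℓ¹` norms of polynomials that are uniform in `m`.

*Polynomials.* Let `R_q(m)` (`taylorTail`) be the part of degree at least `q` in `X - I` of `X^m`.
Then `R_{q+1}(m + e_j) = I_j R_{q+1}(m) + (X_j - I_j) R_q(m)`. If `W` and `W'` are weights with
`W ≤ W'` and `I_j D + (W_j + I_j) ≤ W'_j D`, then induction on `m` bounds the `W`-norm of `R_q(m)` by `W'^m D^q`
(`le_of_recursion`); this replaces estimates of binomial coefficients. The recursion with a formal
variable `Y_j` in place of the factor `X_j - I_j` produces a polynomial homogeneous of degree `q` in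
`Y`, whose coefficients `Q_δ(m)` satisfy `R_q(m) = ∑_{|δ|=q} (X - I)^δ Q_δ(m)` and the same bound
(`exists_taylorQuotient`). On the ball of radius `κs r` the actions are bounded by
`W = κs² W'`, where `W'` bounds them on the ball of radius `r`, and `I ≤ κ² W'`; so
`D = (κs² + κ²) / (1 - κ²)` is admissible (`taylorRate`). It is finite for `κs = 1`, which gives
convergence up to the radius `r`, and for `κ ≤ κs < 1` it is at most `(κ² + κs²) / κs² * c_{κs}`.

*Series.* The tail is the series obtained from `H` by replacing each `|u|^{2m}` by `R_q(m)(|u|²)`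
and expanding (`Ser.transform`), and the function multiplying `(|u|² - I)^δ` is obtained in the same way
from `Q_δ(m)`. The norm of a Hamiltonian is a supremum of explicit positive series at the sequence
`r / weight j`, which dominates the ball entrywise (`hamNorm_le_iSup_majSum`,
`majSum_mul_scale_le_hamNorm`). So a polynomial bound by `K W'^m` becomes a norm bound by
`(r/ρ)² K` (`hamNorm_transform_le`), and linearity carries it over to the Lipschitz part.

*Projections.* The function `w ↦ 𝙷(u, w)` is analytic on the ball of radius `r²`, so its derivatives
at `I` in the direction `|u|² - I` are read off from its power series along a line
(`iteratedFDeriv_eq_of_hasSum_line`), whose coefficients are the Taylor parts of the monomials.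
-/

noncomputable section

namespace NLSTorus

/-! ### Monomials with weights in `[0, ∞]` -/

/-- The monomial `W^m = ∏_j W_j^{m_j}` with values in `[0, ∞]`. -/
def epow (W : ℤ → ℝ≥0∞) (m : MI) : ℝ≥0∞ := m.prod fun j n => W j ^ n

theorem epow_zero (W : ℤ → ℝ≥0∞) : epow W 0 = 1 := Finsupp.prod_zero_index

theorem epow_add (W : ℤ → ℝ≥0∞) (m n : MI) : epow W (m + n) = epow W m * epow W n :=
  Finsupp.prod_add_index' (fun _ => pow_zero _) fun _ _ _ => pow_add _ _ _

theorem epow_single (W : ℤ → ℝ≥0∞) (j : ℤ) : epow W (Finsupp.single j 1) = W j := by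
  simp [epow]

theorem epow_add_single (W : ℤ → ℝ≥0∞) (m : MI) (j : ℤ) :
    epow W (m + Finsupp.single j 1) = epow W m * W j := by
  rw [epow_add, epow_single]

theorem epow_mono {V W : ℤ → ℝ≥0∞} (h : ∀ j, V j ≤ W j) (m : MI) : epow V m ≤ epow W m :=
  Finset.prod_le_prod' fun j _ => pow_le_pow_left' (h j) _

theorem epow_ne_zero {W : ℤ → ℝ≥0∞} (h : ∀ j, W j ≠ 0) (m : MI) : epow W m ≠ 0 :=
  Finset.prod_ne_zero_iff.mpr fun j _ => pow_ne_zero _ (h j)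

theorem epow_ne_top {W : ℤ → ℝ≥0∞} (h : ∀ j, W j ≠ ∞) (m : MI) : epow W m ≠ ∞ :=
  ENNReal.prod_ne_top fun j _ => ENNReal.pow_ne_top (h j)

theorem epow_sq (W : ℤ → ℝ≥0∞) (m : MI) :
    epow (fun j => W j ^ 2) m = epow W m * epow W m := by
  simp only [epow, Finsupp.prod, ← Finset.prod_mul_distrib]
  refine Finset.prod_congr rfl fun j _ => ?_
  rw [← pow_mul, mul_comm, pow_mul, sq]

theorem epow_const_mul (c : ℝ≥0∞) (W : ℤ → ℝ≥0∞) (m : MI) :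
    epow (fun j => c * W j) m = c ^ m.degree * epow W m := by
  simp only [epow, Finsupp.prod, Finsupp.degree, mul_pow, Finset.prod_mul_distrib,
    Finset.prod_pow_eq_pow_sum]
  rfl

theorem enorm_mpow (v : ℤ → ℂ) (m : MI) : ‖mpow v m‖ₑ = epow (fun j => ‖v j‖ₑ) m := by
  simp only [mpow, epow, Finsupp.prod, enorm_eq_nnnorm, nnnorm_prod, nnnorm_pow,
    ENNReal.ofNNReal_finsetProd, ENNReal.coe_pow]

theorem mpow_add (v : ℤ → ℂ) (m n : MI) : mpow v (m + n) = mpow v m * mpow v n :=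
  Finsupp.prod_add_index' (fun _ => pow_zero _) fun _ _ _ => pow_add _ _ _

/-- Induction over multi-indices by adding unit vectors. -/
theorem MI.induction {C : MI → Prop} (h0 : C 0) (h : ∀ m j, C m → C (m + Finsupp.single j 1))
    (m : MI) : C m := by
  have key : ∀ t : Multiset ℤ, C (Multiset.toFinsupp t) := by
    intro t
    induction t using Multiset.induction_on with
    | empty => simpa using h0
    | cons j t ih =>
      have := h _ j ih
      rwa [← Multiset.toFinsupp_singleton, ← map_add, add_comm, Multiset.singleton_add] at this
  simpa using key (Finsupp.toMultiset m)

/-! ### Weighted `ℓ¹` norms of polynomials -/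

/-- The weighted `ℓ¹` norm `∑_l ν(f_l) W^l` of a polynomial whose coefficients are measured
by `ν`. -/
def wsum {R : Type*} [CommSemiring R] (ν : R → ℝ≥0∞) (W : ℤ → ℝ≥0∞) (f : MvPolynomial ℤ R) :
    ℝ≥0∞ :=
  ∑' l : MI, ν (f.coeff l) * epow W l

section wsum

variable {R : Type*} [CommSemiring R] {ν : R → ℝ≥0∞} {W : ℤ → ℝ≥0∞}

theorem wsum_zero (h0 : ν 0 = 0) : wsum ν W (0 : MvPolynomial ℤ R) = 0 := by
  simp [wsum, h0]

theorem wsum_add (hν : ∀ a b, ν (a + b) ≤ ν a + ν b) (f g : MvPolynomial ℤ R) :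
    wsum ν W (f + g) ≤ wsum ν W f + wsum ν W g := by
  simp only [wsum, ← ENNReal.tsum_add, MvPolynomial.coeff_add]
  refine ENNReal.tsum_le_tsum fun l => ?_
  rw [← add_mul]
  exact mul_le_mul_left (hν _ _) _

theorem wsum_C_mul {c : R} {k : ℝ≥0∞} (hc : ∀ b, ν (c * b) ≤ k * ν b) (f : MvPolynomial ℤ R) :
    wsum ν W (MvPolynomial.C c * f) ≤ k * wsum ν W f := by
  simp only [wsum, ← ENNReal.tsum_mul_left, MvPolynomial.coeff_C_mul]
  refine ENNReal.tsum_le_tsum fun l => ?_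
  rw [← mul_assoc]
  exact mul_le_mul_left (hc _) _

theorem wsum_X_mul (h0 : ν 0 = 0) (j : ℤ) (f : MvPolynomial ℤ R) :
    wsum ν W (MvPolynomial.X j * f) = W j * wsum ν W f := by
  have hinj : Function.Injective fun l : MI => l + Finsupp.single j 1 :=
    add_left_injective _
  unfold wsum
  rw [← hinj.tsum_eq, ← ENNReal.tsum_mul_left]
  · refine tsum_congr fun l => ?_
    rw [add_comm l, MvPolynomial.coeff_X_mul, add_comm, epow_add_single]
    ring
  · intro l hl
    rw [Function.mem_support, MvPolynomial.coeff_X_mul'] at hl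
    have hj : j ∈ l.support := by
      by_contra hj
      rw [if_neg hj] at hl
      simp [h0] at hl
    refine ⟨l - Finsupp.single j 1, ?_⟩
    have : Finsupp.single j 1 ≤ l := by
      rw [Finsupp.single_le_iff]
      exact Nat.one_le_iff_ne_zero.mpr (Finsupp.mem_support_iff.mp hj)
    exact tsub_add_cancel_of_le this

theorem wsum_monomial (h0 : ν 0 = 0) (m : MI) (c : R) :
    wsum ν W (MvPolynomial.monomial m c) = ν c * epow W m := by
  unfold wsum
  rw [tsum_eq_single m]
  · simp
  · intro l hl
    rw [MvPolynomial.coeff_monomial, if_neg (Ne.symm hl), h0, zero_mul]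

theorem wsum_C (h0 : ν 0 = 0) (c : R) : wsum ν W (MvPolynomial.C c) = ν c := by
  rw [← MvPolynomial.monomial_zero', wsum_monomial h0, epow_zero, mul_one]

theorem mul_epow_le_wsum (f : MvPolynomial ℤ R) (l : MI) :
    ν (f.coeff l) * epow W l ≤ wsum ν W f :=
  ENNReal.le_tsum (f := fun l : MI => ν (f.coeff l) * epow W l) l

end wsum

/-- The weighted `ℓ¹` norm `∑_l |f_l| W^l` of a real polynomial. -/
abbrev polyNorm (W : ℤ → ℝ≥0∞) (f : MvPolynomial ℤ ℝ) : ℝ≥0∞ := wsum (fun x : ℝ => ‖x‖ₑ) W f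

/-- The value at a point dominated by `W` is bounded by the weighted norm. -/
theorem enorm_aeval_le {W : ℤ → ℝ≥0∞} {w : ℤ → ℂ} (hw : ∀ j, ‖w j‖ₑ ≤ W j)
    (f : MvPolynomial ℤ ℝ) : ‖MvPolynomial.aeval w f‖ₑ ≤ polyNorm W f := by
  have e : MvPolynomial.aeval w f = ∑ l ∈ f.support, ((f.coeff l : ℝ) : ℂ) * mpow w l := by
    rw [MvPolynomial.aeval_def, MvPolynomial.eval₂_eq]
    rfl
  rw [e]
  refine (enorm_sum_le _ _).trans (le_trans (Finset.sum_le_sum fun l _ => ?_)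
    (ENNReal.sum_le_tsum f.support))
  rw [enorm_mul, enorm_mpow]
  refine mul_le_mul' (le_of_eq ?_) (epow_mono hw l)
  simp [enorm_eq_nnnorm]

theorem polyNorm_step (W : ℤ → ℝ≥0∞) (c : ℝ) (j : ℤ) (f g : MvPolynomial ℤ ℝ) :
    polyNorm W (MvPolynomial.C c * f + (MvPolynomial.X j - MvPolynomial.C c) * g) ≤
      ‖c‖ₑ * polyNorm W f + (W j + ‖c‖ₑ) * polyNorm W g := by
  have hadd : ∀ x y : ℝ, ‖x + y‖ₑ ≤ ‖x‖ₑ + ‖y‖ₑ := fun x y => enorm_add_le x y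
  have hmul : ∀ b : ℝ, ‖c * b‖ₑ ≤ ‖c‖ₑ * ‖b‖ₑ := fun b => (enorm_mul c b).le
  have hmul' : ∀ b : ℝ, ‖-c * b‖ₑ ≤ ‖c‖ₑ * ‖b‖ₑ := fun b => by rw [enorm_mul, enorm_neg]
  have e : (MvPolynomial.X j - MvPolynomial.C c) * g =
      MvPolynomial.X j * g + MvPolynomial.C (-c) * g := by
    rw [MvPolynomial.C_neg]; ring
  rw [e, add_mul]
  refine (wsum_add hadd _ _).trans (add_le_add (wsum_C_mul hmul f) ?_)
  refine (wsum_add hadd _ _).trans (add_le_add ?_ (wsum_C_mul hmul' g))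
  rw [wsum_X_mul enorm_zero]

/-! ### Taylor parts and Taylor remainders of monomials -/

/-- `∏_j (I_j + T (X_j - I_j))^{m_j}`, the monomial `X^m` on the line from `I` to `X`. -/
def taylorLine (I : ℤ → ℝ) (m : MI) : Polynomial (MvPolynomial ℤ ℝ) :=
  m.prod fun j n => (Polynomial.C (MvPolynomial.C (I j)) +
    Polynomial.X * Polynomial.C (MvPolynomial.X j - MvPolynomial.C (I j))) ^ n

/-- The part of degree `i` in `X - I` of the Taylor expansion of `X^m` at `I`. -/
def taylorPart (I : ℤ → ℝ) (i : ℕ) (m : MI) : MvPolynomial ℤ ℝ := (taylorLine I m).coeff i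

/-- The part of degree at least `q` in `X - I` of the Taylor expansion of `X^m` at `I`. -/
def taylorTail (I : ℤ → ℝ) (q : ℕ) (m : MI) : MvPolynomial ℤ ℝ :=
  MvPolynomial.monomial m 1 - ∑ i ∈ Finset.range q, taylorPart I i m

theorem taylorLine_zero (I : ℤ → ℝ) : taylorLine I 0 = 1 := Finsupp.prod_zero_index

theorem taylorLine_add_single (I : ℤ → ℝ) (m : MI) (j : ℤ) :
    taylorLine I (m + Finsupp.single j 1) = (Polynomial.C (MvPolynomial.C (I j)) +
      Polynomial.X * Polynomial.C (MvPolynomial.X j - MvPolynomial.C (I j))) * taylorLine I m := by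
  have h := Finsupp.prod_add_index' (f := m) (g := Finsupp.single j 1) (h := fun j n =>
    (Polynomial.C (MvPolynomial.C (I j)) + Polynomial.X * Polynomial.C (MvPolynomial.X j -
      MvPolynomial.C (I j))) ^ n) (fun _ => pow_zero _) fun _ _ _ => pow_add _ _ _
  rw [Finsupp.prod_single_index (h := fun j n => (Polynomial.C (MvPolynomial.C (I j)) +
    Polynomial.X * Polynomial.C (MvPolynomial.X j - MvPolynomial.C (I j))) ^ n) (pow_zero _),
    pow_one] at h
  exact h.trans (mul_comm _ _)

theorem taylorPart_succ_zero (I : ℤ → ℝ) (i : ℕ) : taylorPart I (i + 1) 0 = 0 := by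
  rw [taylorPart, taylorLine_zero, Polynomial.coeff_one, if_neg (Nat.succ_ne_zero i)]

theorem taylorPart_zero_zero (I : ℤ → ℝ) : taylorPart I 0 0 = 1 := by
  rw [taylorPart, taylorLine_zero, Polynomial.coeff_one, if_pos rfl]

theorem taylorPart_zero_add_single (I : ℤ → ℝ) (m : MI) (j : ℤ) :
    taylorPart I 0 (m + Finsupp.single j 1) = MvPolynomial.C (I j) * taylorPart I 0 m := by
  simp [taylorPart, taylorLine_add_single, Polynomial.mul_coeff_zero]

theorem taylorPart_succ_add_single (I : ℤ → ℝ) (i : ℕ) (m : MI) (j : ℤ) :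
    taylorPart I (i + 1) (m + Finsupp.single j 1) = MvPolynomial.C (I j) * taylorPart I (i + 1) m +
      (MvPolynomial.X j - MvPolynomial.C (I j)) * taylorPart I i m := by
  rw [taylorPart, taylorLine_add_single, add_mul, Polynomial.coeff_add, Polynomial.coeff_C_mul,
    mul_assoc, Polynomial.coeff_X_mul, Polynomial.coeff_C_mul]
  rfl

theorem taylorTail_zero (I : ℤ → ℝ) (m : MI) :
    taylorTail I 0 m = MvPolynomial.monomial m 1 := by
  simp [taylorTail]

theorem taylorTail_succ_zero (I : ℤ → ℝ) (q : ℕ) : taylorTail I (q + 1) 0 = 0 := by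
  rw [taylorTail, Finset.sum_range_succ', taylorPart_zero_zero]
  simp [taylorPart_succ_zero]

theorem taylorTail_succ_add_single (I : ℤ → ℝ) (q : ℕ) (m : MI) (j : ℤ) :
    taylorTail I (q + 1) (m + Finsupp.single j 1) = MvPolynomial.C (I j) * taylorTail I (q + 1) m +
      (MvPolynomial.X j - MvPolynomial.C (I j)) * taylorTail I q m := by
  have hm : MvPolynomial.monomial (m + Finsupp.single j 1) (1 : ℝ) =
      MvPolynomial.monomial m 1 * MvPolynomial.X j := by
    rw [MvPolynomial.X, MvPolynomial.monomial_mul, mul_one]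
  have hs : ∑ i ∈ Finset.range (q + 1), taylorPart I i m =
      ∑ i ∈ Finset.range q, taylorPart I (i + 1) m + taylorPart I 0 m :=
    Finset.sum_range_succ' _ _
  rw [taylorTail, taylorTail, taylorTail, hs, Finset.sum_range_succ', hm,
    taylorPart_zero_add_single]
  simp only [taylorPart_succ_add_single, Finset.sum_add_distrib, ← Finset.mul_sum]
  ring

/-! ### Bounds for Taylor parts and remainders -/

theorem recursion_step {a b w x y P D : ℝ≥0∞} {q : ℕ} (hD : a * D + b ≤ w * D)
    (hx : x ≤ P * D ^ (q + 1)) (hy : y ≤ P * D ^ q) : a * x + b * y ≤ P * w * D ^ (q + 1) :=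
  calc a * x + b * y ≤ a * (P * D ^ (q + 1)) + b * (P * D ^ q) := by gcongr
    _ = P * D ^ q * (a * D + b) := by ring
    _ ≤ P * D ^ q * (w * D) := by gcongr
    _ = P * w * D ^ (q + 1) := by ring

/-- A Pascal-type recursion with weights `a_j`, `b_j` is solved by `W^m D^q` as soon as
`a_j D + b_j ≤ W_j D`. -/
theorem le_of_recursion {n : ℕ → MI → ℝ≥0∞} {a b W : ℤ → ℝ≥0∞} {D : ℝ≥0∞}
    (h0 : ∀ m, n 0 m ≤ epow W m) (h1 : ∀ q, n (q + 1) 0 = 0)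
    (h2 : ∀ q m j, n (q + 1) (m + Finsupp.single j 1) ≤ a j * n (q + 1) m + b j * n q m)
    (hD : ∀ j, a j * D + b j ≤ W j * D) (q : ℕ) (m : MI) : n q m ≤ epow W m * D ^ q := by
  induction m using MI.induction generalizing q with
  | h0 =>
    cases q with
    | zero => simpa using h0 0
    | succ q => simp [h1]
  | h m j ih =>
    cases q with
    | zero => simpa using h0 _
    | succ q =>
      rw [epow_add_single]
      exact (h2 q m j).trans (recursion_step (hD j) (ih (q + 1)) (ih q))

theorem polyNorm_taylorPart_le {I : ℤ → ℝ} {W W' : ℤ → ℝ≥0∞} {D : ℝ≥0∞}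
    (hI : ∀ j, ‖I j‖ₑ ≤ W' j) (hD : ∀ j, ‖I j‖ₑ * D + (W j + ‖I j‖ₑ) ≤ W' j * D) (q : ℕ) (m : MI) :
    polyNorm W (taylorPart I q m) ≤ epow W' m * D ^ q := by
  refine le_of_recursion (n := fun q m => polyNorm W (taylorPart I q m)) (fun m => ?_)
    (fun q => ?_) (fun q m j => ?_) hD q m
  · induction m using MI.induction with
    | h0 =>
      rw [taylorPart_zero_zero, ← MvPolynomial.C_1, polyNorm, wsum_C enorm_zero, epow_zero]
      simp
    | h m j ih =>
      rw [taylorPart_zero_add_single, epow_add_single, mul_comm (epow W' m)]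
      refine (wsum_C_mul (fun b => (enorm_mul (I j) b).le) _).trans ?_
      exact mul_le_mul' (hI j) ih
  · rw [taylorPart_succ_zero, polyNorm, wsum_zero enorm_zero]
  · rw [taylorPart_succ_add_single]
    exact polyNorm_step W (I j) j _ _

theorem polyNorm_taylorTail_le {I : ℤ → ℝ} {W W' : ℤ → ℝ≥0∞} {D : ℝ≥0∞}
    (hW : ∀ j, W j ≤ W' j) (hD : ∀ j, ‖I j‖ₑ * D + (W j + ‖I j‖ₑ) ≤ W' j * D) (q : ℕ) (m : MI) :
    polyNorm W (taylorTail I q m) ≤ epow W' m * D ^ q := by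
  refine le_of_recursion (n := fun q m => polyNorm W (taylorTail I q m)) (fun m => ?_)
    (fun q => ?_) (fun q m j => ?_) hD q m
  · rw [taylorTail_zero, polyNorm, wsum_monomial enorm_zero, enorm_one, one_mul]
    exact epow_mono hW m
  · rw [taylorTail_succ_zero, polyNorm, wsum_zero enorm_zero]
  · rw [taylorTail_succ_add_single]
    exact polyNorm_step W (I j) j _ _

theorem le_of_coeff_step_ne_zero {c : ℝ} {j : ℤ} {f g : MvPolynomial ℤ ℝ} {m l : MI}
    (hf : ∀ l, f.coeff l ≠ 0 → l ≤ m) (hg : ∀ l, g.coeff l ≠ 0 → l ≤ m)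
    (h : (MvPolynomial.C c * f + (MvPolynomial.X j - MvPolynomial.C c) * g).coeff l ≠ 0) :
    l ≤ m + Finsupp.single j 1 := by
  by_contra hl
  have h1 : ¬ l ≤ m := fun h' => hl (h'.trans le_self_add)
  have hf0 : f.coeff l = 0 := by_contra fun h' => h1 (hf l h')
  have hg0 : g.coeff l = 0 := by_contra fun h' => h1 (hg l h')
  rw [sub_mul, MvPolynomial.coeff_add, MvPolynomial.coeff_sub, MvPolynomial.coeff_C_mul,
    MvPolynomial.coeff_C_mul, hf0, hg0, MvPolynomial.coeff_X_mul'] at h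
  simp only [mul_zero, sub_zero, zero_add, ne_eq, ite_eq_right_iff, Classical.not_imp] at h
  exact hl (tsub_le_iff_right.mp (hg _ h.2))

theorem le_of_coeff_taylorPart_ne_zero (I : ℤ → ℝ) {i : ℕ} {l m : MI}
    (h : (taylorPart I i m).coeff l ≠ 0) : l ≤ m := by
  induction m using MI.induction generalizing i l with
  | h0 =>
    cases i with
    | zero =>
      rw [taylorPart_zero_zero, MvPolynomial.coeff_one] at h
      exact (of_not_not fun h' => h (if_neg h')).ge
    | succ i => simp [taylorPart_succ_zero] at h
  | h m j ih =>
    cases i with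
    | zero =>
      rw [taylorPart_zero_add_single, MvPolynomial.coeff_C_mul] at h
      exact (ih (right_ne_zero_of_mul h)).trans le_self_add
    | succ i =>
      rw [taylorPart_succ_add_single] at h
      exact le_of_coeff_step_ne_zero (fun _ => ih) (fun _ => ih) h

theorem le_of_coeff_taylorTail_ne_zero (I : ℤ → ℝ) {q : ℕ} {l m : MI}
    (h : (taylorTail I q m).coeff l ≠ 0) : l ≤ m := by
  by_contra hl
  refine h ?_
  rw [taylorTail, MvPolynomial.coeff_sub, MvPolynomial.coeff_monomial,
    if_neg fun h' => hl h'.ge, MvPolynomial.coeff_sum, Finset.sum_eq_zero, sub_zero]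
  exact fun i _ => by_contra fun h' => hl (le_of_coeff_taylorPart_ne_zero I h')

/-- Along the line from `I` to `w` the monomial `w^m` is the polynomial in the parameter whose
coefficients are the Taylor parts. -/
theorem hasSum_mpow_line (I : ℤ → ℝ) (w : ℤ → ℂ) (t : ℂ) (m : MI) :
    HasSum (fun i : ℕ => t ^ i * MvPolynomial.aeval w (taylorPart I i m))
      (mpow (fun j => (I j : ℂ) + t * (w j - I j)) m) := by
  have h : mpow (fun j => (I j : ℂ) + t * (w j - I j)) m =
      Polynomial.eval₂ (MvPolynomial.aeval w : MvPolynomial ℤ ℝ →ₐ[ℝ] ℂ).toRingHom t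
        (taylorLine I m) := by
    induction m using MI.induction with
    | h0 => simp [taylorLine_zero, mpow]
    | h m j ih =>
      rw [taylorLine_add_single, Polynomial.eval₂_mul, ← ih, mpow_add, mul_comm]
      congr 1
      simp [mpow]
  rw [h, Polynomial.eval₂_eq_sum, Polynomial.sum_def]
  have := hasSum_sum_of_ne_finset_zero (L := SummationFilter.unconditional ℕ) (f := fun i : ℕ =>
    t ^ i * MvPolynomial.aeval w (taylorPart I i m)) (s := (taylorLine I m).support) (by
      intro i hi
      rw [taylorPart, Polynomial.notMem_support_iff.mp hi, map_zero, mul_zero])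
  convert this using 2
  exact mul_comm _ _

/-! ### The quotients of the Taylor remainder -/

/-- The weighted `ℓ¹` norm of a polynomial in variables `Y` whose coefficients are polynomials in
`X`, with weights `W` for `X` and `V` for `Y`. -/
abbrev polyNorm₂ (W V : ℤ → ℝ≥0∞) (f : MvPolynomial ℤ (MvPolynomial ℤ ℝ)) : ℝ≥0∞ :=
  wsum (polyNorm W) V f

/-- Polynomials `Q_q(Y)`, homogeneous of degree `q` in `Y` with coefficients in `ℝ[X]`, that become
the Taylor remainder at `Y = X - I`. They depend on the order in which unit vectors are added to
reach `m`, so only their existence is stated. -/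
theorem exists_taylorQuotient (I : ℤ → ℝ) (m : MI) :
    ∃ Q : ℕ → MvPolynomial ℤ (MvPolynomial ℤ ℝ),
      (∀ q, (Q q).IsHomogeneous q) ∧
      (∀ q, MvPolynomial.eval (fun j => MvPolynomial.X j - MvPolynomial.C (I j)) (Q q) =
        taylorTail I q m) ∧
      ∀ (W V W' : ℤ → ℝ≥0∞) (D : ℝ≥0∞), (∀ j, W j ≤ W' j) →
        (∀ j, ‖I j‖ₑ * D + V j ≤ W' j * D) →
        ∀ q, polyNorm₂ W V (Q q) ≤ epow W' m * D ^ q := by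
  have h0 : ∀ W, polyNorm W 0 = 0 := fun W => wsum_zero enorm_zero
  have hadd : ∀ W f g, polyNorm W (f + g) ≤ polyNorm W f + polyNorm W g := fun W f g =>
    wsum_add (fun x y : ℝ => enorm_add_le x y) f g
  induction m using MI.induction with
  | h0 =>
    refine ⟨fun q => if q = 0 then 1 else 0, fun q => ?_, fun q => ?_, ?_⟩
    · beta_reduce
      split_ifs with h
      · subst h; exact MvPolynomial.isHomogeneous_one _ _
      · exact MvPolynomial.isHomogeneous_zero _ _ _
    · beta_reduce
      split_ifs with h
      · subst h; simp [taylorTail_zero]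
      · obtain ⟨q, rfl⟩ := Nat.exists_eq_succ_of_ne_zero h
        rw [taylorTail_succ_zero, map_zero]
    · intro W V W' D _ _ q
      dsimp only
      split_ifs with h
      · subst h
        rw [← MvPolynomial.C_1, polyNorm₂, wsum_C (h0 W), ← MvPolynomial.C_1, polyNorm,
          wsum_C enorm_zero, epow_zero]
        simp
      · rw [polyNorm₂, wsum_zero (h0 W)]
        exact zero_le
  | h m j ih =>
    obtain ⟨Q, hQ1, hQ2, hQ3⟩ := ih
    refine ⟨fun q => Nat.casesOn q
      (MvPolynomial.C (MvPolynomial.monomial (m + Finsupp.single j 1) 1))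
      fun q => MvPolynomial.C (MvPolynomial.C (I j)) * Q (q + 1) + MvPolynomial.X j * Q q,
      fun q => ?_, fun q => ?_, ?_⟩
    · cases q with
      | zero => exact MvPolynomial.isHomogeneous_C _ _
      | succ q =>
        refine MvPolynomial.IsHomogeneous.add ?_ ?_
        · simpa using (MvPolynomial.isHomogeneous_C ℤ (MvPolynomial.C (I j))).mul (hQ1 (q + 1))
        · rw [add_comm q 1]
          exact (MvPolynomial.isHomogeneous_X _ j).mul (hQ1 q)
    · cases q with
      | zero => simp [taylorTail_zero]
      | succ q => simp [taylorTail_succ_add_single, hQ2]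
    · intro W V W' D hW hD q
      cases q with
      | zero =>
        change polyNorm₂ W V (MvPolynomial.C
          (MvPolynomial.monomial (m + Finsupp.single j 1) 1)) ≤ _
        rw [polyNorm₂, wsum_C (h0 W), polyNorm, wsum_monomial enorm_zero, enorm_one, one_mul,
          pow_zero, mul_one]
        exact epow_mono hW _
      | succ q =>
        simp only
        rw [epow_add_single]
        refine le_trans ?_ (recursion_step (hD j) (hQ3 W V W' D hW hD (q + 1))
          (hQ3 W V W' D hW hD q))
        refine (wsum_add (hadd W) _ _).trans (add_le_add (wsum_C_mul (fun b => ?_) _) ?_)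
        · exact wsum_C_mul (fun b => (enorm_mul (I j) b).le) b
        · rw [wsum_X_mul (h0 W)]

variable {θ p s a : ℝ}

/-! ### The extremal sequence of a ball -/

theorem one_le_jap (j : ℤ) : 1 ≤ jap j := le_max_right _ _

/-- The largest modulus `ρ / weight j` of the `j`-th entry on the ball of radius `ρ`. -/
def radius (θ p s a ρ : ℝ) (j : ℤ) : ℝ := ρ / weight θ p s a j

theorem radius_pos {ρ : ℝ} (hρ : 0 < ρ) (j : ℤ) : 0 < radius θ p s a ρ j :=
  div_pos hρ (weight_pos θ p s a j)

theorem W.norm_apply_le_radius {u : W θ p s a} {ρ : ℝ} (hu : ‖u‖ ≤ ρ) (j : ℤ) :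
    ‖u j‖ ≤ radius θ p s a ρ j := by
  rw [radius, le_div_iff₀ (weight_pos θ p s a j)]
  exact (le_ciSup u.bdd j).trans hu

theorem summable_inv_jap_sq : Summable fun j : ℤ => (jap j ^ 2)⁻¹ := by
  have h1 := Real.summable_abs_int_rpow (b := 2) one_lt_two
  have h2 : Summable fun j : ℤ => if j = 0 then (1 : ℝ) else 0 :=
    summable_of_ne_finset_zero (s := {0}) fun j hj => if_neg (by simpa using hj)
  refine Summable.of_nonneg_of_le (fun j => by positivity) (fun j => ?_) (h1.add h2)
  by_cases hj : j = 0
  · subst hj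
    simp [jap]
  · have h : (1 : ℝ) ≤ |(j : ℝ)| := by exact_mod_cast Int.one_le_abs hj
    rw [if_neg hj, add_zero, jap, max_eq_left h, Real.rpow_neg (by positivity)]
    norm_num

theorem jap_le_weight (hp : 1 < p) (hs : 0 < s) (ha : 0 ≤ a) (j : ℤ) :
    jap j ≤ weight θ p s a j := by
  have h1 := one_le_jap j
  have h0 : 0 ≤ jap j := zero_le_one.trans h1
  have h2 : jap j ^ (1 : ℝ) ≤ jap j ^ p := Real.rpow_le_rpow_of_exponent_le h1 hp.le
  rw [Real.rpow_one] at h2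
  have h3 : 1 ≤ Real.exp (a * |(j : ℝ)| + s * jap j ^ θ) :=
    Real.one_le_exp (add_nonneg (by positivity) (mul_nonneg hs.le (Real.rpow_nonneg h0 _)))
  calc jap j ≤ jap j ^ p * 1 := by simpa using h2
    _ ≤ weight θ p s a j := mul_le_mul_of_nonneg_left h3 (Real.rpow_nonneg h0 _)

/-- The sequence `j ↦ ρ / weight j`, which dominates the ball of radius `ρ` entrywise and itself
belongs to it; it is square summable since `p > 1`. -/
def extremal (θ : ℝ) {p s a : ℝ} (hp : 1 < p) (hs : 0 < s) (ha : 0 ≤ a) (ρ : ℝ) : W θ p s a :=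
  ⟨fun j => (radius θ p s a ρ j : ℂ), by
    refine ⟨?_, |ρ|, ?_⟩
    · refine Summable.of_nonneg_of_le (fun j => by positivity) (fun j => ?_)
        (summable_inv_jap_sq.mul_left (ρ ^ 2))
      have h1 := one_le_jap j
      have h2 := jap_le_weight (θ := θ) hp hs ha j
      rw [Complex.norm_real, Real.norm_eq_abs, sq_abs, radius, div_pow, div_eq_mul_inv]
      gcongr
    · rintro _ ⟨j, rfl⟩
      have h := weight_pos θ p s a j
      simp only [Complex.norm_real, radius, Real.norm_eq_abs, abs_div, abs_of_pos h]
      rw [div_mul_cancel₀ _ h.ne']⟩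

theorem extremal_apply (hp : 1 < p) (hs : 0 < s) (ha : 0 ≤ a) (ρ : ℝ) (j : ℤ) :
    extremal θ hp hs ha ρ j = (radius θ p s a ρ j : ℂ) := rfl

theorem norm_extremal_le (hp : 1 < p) (hs : 0 < s) (ha : 0 ≤ a) {ρ : ℝ} (hρ : 0 < ρ) :
    ‖extremal θ hp hs ha ρ‖ ≤ ρ := by
  refine ciSup_le fun j => ?_
  have h := weight_pos θ p s a j
  rw [extremal_apply, Complex.norm_real, Real.norm_eq_abs, abs_of_pos (radius_pos hρ j), radius,
    div_mul_cancel₀ _ h.ne']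

/-- `radius` with values in `[0, ∞]`. -/
def eradius (θ p s a ρ : ℝ) (j : ℤ) : ℝ≥0∞ := ENNReal.ofReal (radius θ p s a ρ j)

theorem eradius_ne_zero {ρ : ℝ} (hρ : 0 < ρ) (j : ℤ) : eradius θ p s a ρ j ≠ 0 :=
  (ENNReal.ofReal_pos.mpr (radius_pos hρ j)).ne'

theorem eradius_ne_top {ρ : ℝ} (j : ℤ) : eradius θ p s a ρ j ≠ ∞ := ENNReal.ofReal_ne_top

theorem W.enorm_apply_le_eradius {u : W θ p s a} {ρ : ℝ} (hu : ‖u‖ ≤ ρ) (j : ℤ) :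
    ‖u j‖ₑ ≤ eradius θ p s a ρ j := by
  rw [← ofReal_norm]
  exact ENNReal.ofReal_le_ofReal (W.norm_apply_le_radius hu j)

theorem enorm_extremal_apply (hp : 1 < p) (hs : 0 < s) (ha : 0 ≤ a) {ρ : ℝ} (hρ : 0 < ρ) (j : ℤ) :
    ‖extremal θ hp hs ha ρ j‖ₑ = eradius θ p s a ρ j := by
  rw [← ofReal_norm, extremal_apply, Complex.norm_real, Real.norm_eq_abs,
    abs_of_pos (radius_pos hρ j)]
  rfl

/-- The value of `|u^α ū^β|` at the extremal sequence of radius `ρ`. -/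
def emono (θ p s a ρ : ℝ) (x : MI × MI) : ℝ≥0∞ :=
  epow (eradius θ p s a ρ) x.1 * epow (eradius θ p s a ρ) x.2

theorem emono_ne_zero {ρ : ℝ} (hρ : 0 < ρ) (x : MI × MI) : emono θ p s a ρ x ≠ 0 :=
  mul_ne_zero (epow_ne_zero (eradius_ne_zero hρ) _) (epow_ne_zero (eradius_ne_zero hρ) _)

theorem emono_ne_top {ρ : ℝ} (x : MI × MI) : emono θ p s a ρ x ≠ ∞ :=
  ENNReal.mul_ne_top (epow_ne_top eradius_ne_top _) (epow_ne_top eradius_ne_top _)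

theorem enorm_mono (u : ℤ → ℂ) (α β : MI) :
    ‖mono u α β‖ₑ = epow (fun j => ‖u j‖ₑ) α * epow (fun j => ‖u j‖ₑ) β := by
  rw [mono, enorm_mul, enorm_mpow, enorm_mpow]
  simp only [RCLike.enorm_conj]

theorem enorm_mono_le {u : ℤ → ℂ} {ρ : ℝ} (hu : ∀ j, ‖u j‖ₑ ≤ eradius θ p s a ρ j)
    (x : MI × MI) : ‖mono u x.1 x.2‖ₑ ≤ emono θ p s a ρ x := by
  rw [enorm_mono]
  exact mul_le_mul' (epow_mono hu _) (epow_mono hu _)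

/-! ### Majorant sums -/

/-- The weighted sum `∑_x |H_x| φ(x) ρ^{|x|} / weight^x` of the absolute values of the terms of a
series at the extremal sequence of radius `ρ`. -/
def majSum (θ p s a ρ : ℝ) (φ : MI × MI → ℝ≥0∞) (H : Ser) : ℝ≥0∞ :=
  ∑' x : MI × MI, ‖H x.1 x.2‖ₑ * (φ x * emono θ p s a ρ x)

/-- The factor `e^{η|π(α-β)|}`. -/
def momFactor (η : ℝ) (x : MI × MI) : ℝ≥0∞ :=
  ENNReal.ofReal (Real.exp (η * |((momentum x.1 - momentum x.2 : ℤ) : ℝ)|))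

theorem momentum_add (α β : MI) : momentum (α + β) = momentum α + momentum β :=
  Finsupp.sum_add_index' (by simp) (by intros; push_cast; ring)

theorem momFactor_add (η : ℝ) (m α β : MI) : momFactor η (m + α, m + β) = momFactor η (α, β) := by
  simp only [momFactor, momentum_add, add_sub_add_left_eq_sub]

theorem one_le_momFactor {η : ℝ} (hη : 0 ≤ η) (x : MI × MI) : 1 ≤ momFactor η x := by
  rw [← ENNReal.ofReal_one]
  exact ENNReal.ofReal_le_ofReal (Real.one_le_exp (by positivity))

theorem enorm_majorant (η : ℝ) (H : Ser) (x : MI × MI) :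
    ‖H.majorant η x.1 x.2‖ₑ = ‖H x.1 x.2‖ₑ * momFactor η x := by
  rw [Ser.majorant, ← ofReal_norm, Complex.norm_real, Real.norm_eq_abs,
    abs_of_nonneg (by positivity),
    ENNReal.ofReal_mul (norm_nonneg _), ofReal_norm]
  rfl

theorem majSum_majorant (ρ η : ℝ) (H : Ser) :
    majSum θ p s a ρ (fun _ => 1) (H.majorant η) = majSum θ p s a ρ (momFactor η) H := by
  refine tsum_congr fun x => ?_
  rw [enorm_majorant, one_mul, mul_assoc]

theorem majSum_mono {ρ : ℝ} {φ ψ : MI × MI → ℝ≥0∞} (h : ∀ x, φ x ≤ ψ x) (H : Ser) :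
    majSum θ p s a ρ φ H ≤ majSum θ p s a ρ ψ H :=
  ENNReal.tsum_le_tsum fun x => mul_le_mul_right (mul_le_mul_left (h x) _) _

theorem majSum_sub_le (ρ : ℝ) (φ : MI × MI → ℝ≥0∞) (H H' : Ser) :
    majSum θ p s a ρ φ (H - H') ≤ majSum θ p s a ρ φ H + majSum θ p s a ρ φ H' := by
  unfold majSum
  rw [← ENNReal.tsum_add]
  refine ENNReal.tsum_le_tsum fun x => ?_
  rw [← add_mul]
  exact mul_le_mul_left (enorm_sub_le (a := H x.1 x.2) (b := H' x.1 x.2)) _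

theorem summable_norm_of_tsum_enorm_ne_top {ι : Type*} {f : ι → ℂ} (h : ∑' i, ‖f i‖ₑ ≠ ∞) :
    Summable fun i => ‖f i‖ := by
  have := ENNReal.summable_toReal h
  simpa using this

theorem tsum_enorm_ne_top_of_summable_norm {ι : Type*} {f : ι → ℂ} (h : Summable fun i => ‖f i‖) :
    ∑' i, ‖f i‖ₑ ≠ ∞ := by
  simpa only [ofReal_norm] using h.tsum_ofReal_ne_top

theorem majSum_ne_top_of_isMajorantAnalytic (hp : 1 < p) (hs : 0 < s) (ha : 0 ≤ a) {ρ : ℝ}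
    (hρ : 0 < ρ) {H : Ser} (h : IsMajorantAnalytic θ p s a ρ H) :
    majSum θ p s a ρ (fun _ => 1) H ≠ ∞ := by
  have := tsum_enorm_ne_top_of_summable_norm
    (h.summable (extremal θ hp hs ha ρ) (norm_extremal_le hp hs ha hρ))
  refine ne_of_eq_of_ne (tsum_congr fun x => ?_) this
  rw [enorm_mul, enorm_mono, one_mul]
  simp only [enorm_extremal_apply hp hs ha hρ]
  rfl

theorem tsum_enorm_mul_mono_le {u : ℤ → ℂ} {ρ : ℝ} (hu : ∀ j, ‖u j‖ₑ ≤ eradius θ p s a ρ j)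
    (H : Ser) :
    ∑' x : MI × MI, ‖H x.1 x.2 * mono u x.1 x.2‖ₑ ≤ majSum θ p s a ρ (fun _ => 1) H := by
  refine ENNReal.tsum_le_tsum fun x => ?_
  rw [enorm_mul, one_mul]
  exact mul_le_mul_right (enorm_mono_le hu x) _

/-! ### The norm of a vector field as a majorant sum -/

/-- The factor `e^{η|π(α-β)|} β_j` of the coefficients of the vector field of a majorant. -/
def fieldFactor (η : ℝ) (j : ℤ) (x : MI × MI) : ℝ≥0∞ := momFactor η x * (x.2 j : ℝ≥0∞)

/-- The scaling factor `(weight j / ρ)²`. -/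
def scale (θ p s a ρ : ℝ) (j : ℤ) : ℝ≥0∞ := ENNReal.ofReal ((weight θ p s a j / ρ) ^ 2)

theorem eradius_mul_ofReal_div {ρ : ℝ} (hρ : 0 < ρ) (j : ℤ) :
    eradius θ p s a ρ j * ENNReal.ofReal (weight θ p s a j / ρ) = 1 := by
  have := weight_pos θ p s a j
  rw [eradius, ← ENNReal.ofReal_mul (radius_pos hρ j).le, radius, div_mul_div_cancel₀' hρ.ne']
  simp [this.ne']

/-- Lowering an exponent divides by the radius. The factor `β_j` on both sides takes care of the
truncated subtraction in the case `β_j = 0`. -/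
theorem cast_mul_epow_sub_single {ρ : ℝ} (hρ : 0 < ρ) (β : MI) (j : ℤ) :
    (β j : ℝ≥0∞) * epow (eradius θ p s a ρ) (β - Finsupp.single j 1) =
      β j * epow (eradius θ p s a ρ) β * ENNReal.ofReal (weight θ p s a j / ρ) := by
  by_cases h : β j = 0
  · simp [h]
  · have h1 : Finsupp.single j 1 ≤ β := by
      rw [Finsupp.single_le_iff]
      exact Nat.one_le_iff_ne_zero.mpr h
    have h2 : epow (eradius θ p s a ρ) β =
        epow (eradius θ p s a ρ) (β - Finsupp.single j 1) * eradius θ p s a ρ j := by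
      rw [← epow_add_single, tsub_add_cancel_of_le h1]
    rw [h2, mul_assoc, mul_assoc, eradius_mul_ofReal_div hρ, mul_one]

theorem ofReal_div_mul_ofReal {ρ : ℝ} (hρ : 0 < ρ) (j : ℤ) :
    ENNReal.ofReal (weight θ p s a j / ρ) * ENNReal.ofReal (weight θ p s a j) =
      scale θ p s a ρ j * ENNReal.ofReal ρ := by
  have := weight_pos θ p s a j
  rw [scale, ← ENNReal.ofReal_mul (by positivity), ← ENNReal.ofReal_mul (by positivity)]
  congr 1
  field_simp

theorem tsum_majorant_field {ρ : ℝ} (hρ : 0 < ρ) (η : ℝ) (H : Ser) (j : ℤ) :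
    ∑' x : MI × MI, ‖H x.1 x.2‖ₑ * momFactor η x * ((x.2 j : ℝ≥0∞) *
        (epow (eradius θ p s a ρ) x.1 * epow (eradius θ p s a ρ) (x.2 - Finsupp.single j 1))) =
      majSum θ p s a ρ (fieldFactor η j) H * ENNReal.ofReal (weight θ p s a j / ρ) := by
  rw [majSum, ← ENNReal.tsum_mul_right]
  refine tsum_congr fun x => ?_
  rw [mul_left_comm (x.2 j : ℝ≥0∞), cast_mul_epow_sub_single hρ, fieldFactor, emono]
  ring

theorem enorm_vectorField_majorant_le {ρ : ℝ} (hρ : 0 < ρ) (η : ℝ) (H : Ser) {u : ℤ → ℂ}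
    (hu : ∀ j, ‖u j‖ₑ ≤ eradius θ p s a ρ j) (j : ℤ) :
    ‖(H.majorant η).vectorField u j‖ₑ ≤
      majSum θ p s a ρ (fieldFactor η j) H * ENNReal.ofReal (weight θ p s a j / ρ) := by
  rw [← tsum_majorant_field hρ, Ser.vectorField, enorm_mul]
  have : ‖Complex.I‖ₑ = 1 := by rw [← ofReal_norm]; simp
  rw [this, one_mul]
  refine enorm_tsum_le_tsum_enorm.trans (ENNReal.tsum_le_tsum fun x => ?_)
  rw [enorm_mul, enorm_mul, enorm_majorant, mul_assoc]
  have hc : ‖(x.2 j : ℂ)‖ₑ = (x.2 j : ℝ≥0∞) := by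
    rw [← ofReal_norm, Complex.norm_natCast, ENNReal.ofReal_natCast]
  rw [hc]
  gcongr
  exact enorm_mono_le hu (x.1, x.2 - Finsupp.single j 1)

/-- No convergence is needed here: where the differentiated series diverges, the vector field has
the value `0`. -/
theorem hamNorm_le_iSup_majSum {ρ : ℝ} (hρ : 0 < ρ) (η : ℝ) (H : Ser) :
    hamNorm θ p s a ρ η H ≤
      ⨆ j : ℤ, majSum θ p s a ρ (fieldFactor η j) H * scale θ p s a ρ j := by
  refine ENNReal.div_le_of_le_mul (iSup₂_le fun u hu => iSup_le fun j => ?_)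
  calc ‖(H.majorant η).vectorField u j‖ₑ * ENNReal.ofReal (weight θ p s a j)
      ≤ majSum θ p s a ρ (fieldFactor η j) H * ENNReal.ofReal (weight θ p s a j / ρ) *
          ENNReal.ofReal (weight θ p s a j) := by
        gcongr
        exact enorm_vectorField_majorant_le hρ η H (fun j => W.enorm_apply_le_eradius hu j) j
    _ = majSum θ p s a ρ (fieldFactor η j) H * scale θ p s a ρ j * ENNReal.ofReal ρ := by
        rw [mul_assoc, ofReal_div_mul_ofReal hρ, mul_assoc]
    _ ≤ _ := by
        gcongr
        exact le_iSup (fun j : ℤ => majSum θ p s a ρ (fieldFactor η j) H * scale θ p s a ρ j) j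

theorem emono_mul_radius {ρ t : ℝ} (ht : 0 < t) (x : MI × MI) :
    emono θ p s a (t * ρ) x =
      ENNReal.ofReal t ^ (x.1.degree + x.2.degree) * emono θ p s a ρ x := by
  have h : eradius θ p s a (t * ρ) = fun j => ENNReal.ofReal t * eradius θ p s a ρ j := by
    funext j
    rw [eradius, eradius, radius, radius, mul_div_assoc, ENNReal.ofReal_mul ht.le]
  rw [emono, emono, h, epow_const_mul, epow_const_mul, pow_add]
  ring

/-- Inside the ball the differentiated series is dominated by the series itself. -/
theorem majSum_fieldFactor_ne_top {ρ t η : ℝ} (ht0 : 0 < t) (ht1 : t < 1) {H : Ser}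
    (h : majSum θ p s a ρ (momFactor η) H ≠ ∞) (j : ℤ) :
    majSum θ p s a (t * ρ) (fieldFactor η j) H ≠ ∞ := by
  -- `n tⁿ ≤ 1 + t + ⋯ + tⁿ⁻¹`, which absorbs the factor `β_j` of the derivative
  have hn : ∀ n : ℕ, (n : ℝ) * t ^ n ≤ (1 - t)⁻¹ := by
    intro n
    have h1 : ∑ i ∈ Finset.range n, t ^ n ≤ ∑ i ∈ Finset.range n, t ^ i :=
      Finset.sum_le_sum fun i hi =>
        pow_le_pow_of_le_one ht0.le ht1.le (Finset.mem_range.mp hi).le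
    have h2 : ∑ i ∈ Finset.range n, t ^ i ≤ (1 - t)⁻¹ := by
      rw [← tsum_geometric_of_lt_one ht0.le ht1]
      exact (summable_geometric_of_lt_one ht0.le ht1).sum_le_tsum _ fun i _ => by positivity
    simpa using h1.trans h2
  have key : majSum θ p s a (t * ρ) (fieldFactor η j) H ≤
      ENNReal.ofReal (1 - t)⁻¹ * majSum θ p s a ρ (momFactor η) H := by
    rw [majSum, majSum, ← ENNReal.tsum_mul_left]
    refine ENNReal.tsum_le_tsum fun x => ?_
    rw [emono_mul_radius ht0]
    have hx : (x.2 j : ℝ≥0∞) * ENNReal.ofReal t ^ (x.1.degree + x.2.degree) ≤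
        ENNReal.ofReal (1 - t)⁻¹ := by
      have hj : x.2 j ≤ x.1.degree + x.2.degree := (Finsupp.le_degree j x.2).trans le_add_self
      rw [← ENNReal.ofReal_natCast, ← ENNReal.ofReal_pow ht0.le,
        ← ENNReal.ofReal_mul (Nat.cast_nonneg _)]
      refine ENNReal.ofReal_le_ofReal (le_trans ?_ (hn (x.1.degree + x.2.degree)))
      gcongr
    calc ‖H x.1 x.2‖ₑ * (fieldFactor η j x *
          (ENNReal.ofReal t ^ (x.1.degree + x.2.degree) * emono θ p s a ρ x))
        = (x.2 j * ENNReal.ofReal t ^ (x.1.degree + x.2.degree)) *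
          (‖H x.1 x.2‖ₑ * (momFactor η x * emono θ p s a ρ x)) := by
          rw [fieldFactor]; ring
      _ ≤ _ := mul_le_mul_left hx _
  exact ne_top_of_le_ne_top (ENNReal.mul_ne_top ENNReal.ofReal_ne_top h) key

/-- At an extremal sequence all terms of the vector field of a majorant are nonnegative, so that
nothing is lost in the triangle inequality. -/
theorem enorm_vectorField_extremal (hp : 1 < p) (hs : 0 < s) (ha : 0 ≤ a) {ρ η : ℝ} (hρ : 0 < ρ)
    {H : Ser} {j : ℤ} (h : majSum θ p s a ρ (fieldFactor η j) H ≠ ∞) :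
    ‖(H.majorant η).vectorField (extremal θ hp hs ha ρ) j‖ₑ =
      majSum θ p s a ρ (fieldFactor η j) H * ENNReal.ofReal (weight θ p s a j / ρ) := by
  have hU : ∀ m : MI, mpow (extremal θ hp hs ha ρ) m =
      ((m.prod fun j n => radius θ p s a ρ j ^ n : ℝ) : ℂ) := by
    intro m
    simp only [mpow, Finsupp.prod, extremal_apply, Complex.ofReal_prod, Complex.ofReal_pow]
  have hV : ∀ m : MI, mpow (fun i => (starRingEnd ℂ) (extremal θ hp hs ha ρ i)) m =
      ((m.prod fun j n => radius θ p s a ρ j ^ n : ℝ) : ℂ) := by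
    intro m
    rw [← hU]
    simp only [extremal_apply, Complex.conj_ofReal]
    rfl
  set b : MI × MI → ℝ := fun x => ‖H x.1 x.2‖ *
    Real.exp (η * |((momentum x.1 - momentum x.2 : ℤ) : ℝ)|) * (x.2 j) *
    ((x.1.prod fun j n => radius θ p s a ρ j ^ n) *
      ((x.2 - Finsupp.single j 1).prod fun j n => radius θ p s a ρ j ^ n)) with hb
  have hb0 : ∀ x, 0 ≤ b x := fun x => by
    have : ∀ m : MI, 0 ≤ m.prod fun j n => radius θ p s a ρ j ^ n := fun m =>
      Finset.prod_nonneg fun j _ => pow_nonneg (radius_pos hρ j).le _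
    have h1 := this x.1
    have h2 := this (x.2 - Finsupp.single j 1)
    positivity
  have he : ∀ m : MI, epow (eradius θ p s a ρ) m =
      ENNReal.ofReal (m.prod fun j n => radius θ p s a ρ j ^ n) := fun m => by
    rw [epow, Finsupp.prod, Finsupp.prod,
      ENNReal.ofReal_prod_of_nonneg fun j _ => pow_nonneg (radius_pos hρ j).le _]
    exact Finset.prod_congr rfl fun j _ => (ENNReal.ofReal_pow (radius_pos hρ j).le _).symm
  have hbe : ∀ x, ENNReal.ofReal (b x) = ‖H x.1 x.2‖ₑ * momFactor η x * ((x.2 j : ℝ≥0∞) *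
      (epow (eradius θ p s a ρ) x.1 *
        epow (eradius θ p s a ρ) (x.2 - Finsupp.single j 1))) := fun x => by
    have : ∀ m : MI, 0 ≤ m.prod fun j n => radius θ p s a ρ j ^ n := fun m =>
      Finset.prod_nonneg fun j _ => pow_nonneg (radius_pos hρ j).le _
    have h1 := this x.1
    rw [he, he, ← ofReal_norm, momFactor, ← ENNReal.ofReal_natCast, ← ENNReal.ofReal_mul h1,
      ← ENNReal.ofReal_mul (by positivity), ← ENNReal.ofReal_mul (by positivity),
      ← ENNReal.ofReal_mul (by positivity), mul_assoc]
    simp only [hb, mul_assoc]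
  have hsum : ∑' x, ENNReal.ofReal (b x) =
      majSum θ p s a ρ (fieldFactor η j) H * ENNReal.ofReal (weight θ p s a j / ρ) := by
    rw [← tsum_majorant_field hρ]
    exact tsum_congr hbe
  have hfin : ∑' x, ENNReal.ofReal (b x) ≠ ∞ := by
    rw [hsum]
    exact ENNReal.mul_ne_top h ENNReal.ofReal_ne_top
  have hbs : Summable b := by
    have := ENNReal.summable_toReal hfin
    simpa [ENNReal.toReal_ofReal (hb0 _)] using this
  have hval : ∑' x : MI × MI, H.majorant η x.1 x.2 * (x.2 j : ℂ) *
      mono (extremal θ hp hs ha ρ) x.1 (x.2 - Finsupp.single j 1) = ((∑' x, b x : ℝ) : ℂ) := by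
    rw [Complex.ofReal_tsum]
    refine tsum_congr fun x => ?_
    rw [mono, hU, hV, Ser.majorant]
    push_cast [hb]
    ring
  rw [Ser.vectorField, hval, ← hsum, ← ENNReal.ofReal_tsum_of_nonneg hb0 hbs, ← ofReal_norm,
    norm_mul, Complex.norm_I, one_mul, Complex.norm_real, Real.norm_eq_abs,
    abs_of_nonneg (tsum_nonneg hb0)]

/-- The norm controls the differentiated series up to the boundary of the ball: inside the ball the
series converges, and the bound passes to the limit for each finite partial sum. -/
theorem majSum_mul_scale_le_hamNorm (hp : 1 < p) (hs : 0 < s) (ha : 0 ≤ a) {r η : ℝ} (hr : 0 < r)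
    {H : Ser} (h : majSum θ p s a r (momFactor η) H ≠ ∞) (j : ℤ) :
    majSum θ p s a r (fieldFactor η j) H * scale θ p s a r j ≤ hamNorm θ p s a r η H := by
  have hr' : ENNReal.ofReal r ≠ 0 := (ENNReal.ofReal_pos.mpr hr).ne'
  have hin : ∀ t : ℝ, 0 < t → t < 1 → majSum θ p s a (t * r) (fieldFactor η j) H *
      scale θ p s a r j ≤ hamNorm θ p s a r η H := by
    intro t ht0 ht1
    have htr : 0 < t * r := mul_pos ht0 hr
    have hle : t * r ≤ r := by nlinarith
    have hw := weight_pos θ p s a j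
    rw [hamNorm, ENNReal.le_div_iff_mul_le (Or.inl hr') (Or.inl ENNReal.ofReal_ne_top), mul_assoc,
      ← ofReal_div_mul_ofReal hr, ← mul_assoc]
    refine le_trans ?_ (le_iSup₂_of_le (extremal θ hp hs ha (t * r))
      ((norm_extremal_le hp hs ha htr).trans hle) (le_iSup _ j))
    rw [enorm_vectorField_extremal hp hs ha htr (majSum_fieldFactor_ne_top ht0 ht1 h j)]
    gcongr
  unfold majSum at hin ⊢
  rw [← ENNReal.tsum_mul_right, ENNReal.tsum_eq_iSup_sum]
  refine iSup_le fun S => ?_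
  -- each finite partial sum is continuous in the radius
  have hlim : Filter.Tendsto (fun t : ℝ => ∑ x ∈ S, ‖H x.1 x.2‖ₑ * (fieldFactor η j x *
      (ENNReal.ofReal t ^ (x.1.degree + x.2.degree) * emono θ p s a r x)) * scale θ p s a r j)
      (nhdsWithin 1 (Set.Iio 1)) (nhds (∑ x ∈ S, ‖H x.1 x.2‖ₑ * (fieldFactor η j x *
        (ENNReal.ofReal 1 ^ (x.1.degree + x.2.degree) * emono θ p s a r x)) *
          scale θ p s a r j)) := by
    refine (Continuous.tendsto ?_ 1).mono_left nhdsWithin_le_nhds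
    refine continuous_finsetSum _ fun x _ => ?_
    have h1 : fieldFactor η j x ≠ ∞ :=
      ENNReal.mul_ne_top ENNReal.ofReal_ne_top (ENNReal.natCast_ne_top _)
    have h2 : scale θ p s a r j ≠ ∞ := ENNReal.ofReal_ne_top
    refine (ENNReal.continuous_mul_const h2).comp ((ENNReal.continuous_const_mul enorm_ne_top).comp
      ((ENNReal.continuous_const_mul h1).comp ((ENNReal.continuous_mul_const
        (emono_ne_top x)).comp ?_)))
    exact (ENNReal.continuous_pow _).comp ENNReal.continuous_ofReal
  simp only [ENNReal.ofReal_one, one_pow, one_mul] at hlim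
  refine le_of_tendsto hlim ?_
  have hev : Set.Ioo (0 : ℝ) 1 ∈ nhdsWithin (1 : ℝ) (Set.Iio 1) := Ioo_mem_nhdsLT one_pos
  filter_upwards [hev] with t ht
  refine le_trans ?_ (hin t ht.1 ht.2)
  rw [← ENNReal.tsum_mul_right]
  refine le_trans (Finset.sum_le_sum fun x _ => ?_) (ENNReal.sum_le_tsum S)
  rw [emono_mul_radius ht.1]

/-! ### Splitting off the common part of two multi-indices -/

/-- Pairs of multi-indices with disjoint supports. -/
abbrev DisjointPair : Type := {d : MI × MI // d.1 ⊓ d.2 = 0}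

theorem add_inf_add (m : MI) (d : DisjointPair) : (m + d.1.1) ⊓ (m + d.1.2) = m := by
  ext i
  have h := DFunLike.congr_fun d.2 i
  simp only [Finsupp.inf_apply, Finsupp.add_apply, Finsupp.coe_zero, Pi.zero_apply] at h ⊢
  omega

/-- Every pair `(α, β)` is uniquely `(m + α', m + β')` with `α'`, `β'` of disjoint supports, namely
with `m = min(α, β)`. -/
def splitEquiv : MI × DisjointPair ≃ MI × MI where
  toFun y := (y.1 + y.2.1.1, y.1 + y.2.1.2)
  invFun x := (x.1 ⊓ x.2, ⟨(x.1 - x.1 ⊓ x.2, x.2 - x.1 ⊓ x.2), by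
    ext i
    simp only [Finsupp.inf_apply, Finsupp.tsub_apply, Finsupp.coe_zero, Pi.zero_apply]
    omega⟩)
  left_inv y := by
    obtain ⟨m, d⟩ := y
    refine Prod.ext (add_inf_add m d) (Subtype.ext (Prod.ext ?_ ?_)) <;>
      simp only [add_inf_add, add_tsub_cancel_left]
  right_inv x := Prod.ext (add_tsub_cancel_of_le inf_le_left) (add_tsub_cancel_of_le inf_le_right)

theorem splitEquiv_apply (m : MI) (d : DisjointPair) :
    splitEquiv (m, d) = (m + d.1.1, m + d.1.2) := rfl

theorem emono_add (ρ : ℝ) (m α β : MI) : emono θ p s a ρ (m + α, m + β) =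
    epow (fun j => eradius θ p s a ρ j ^ 2) m * emono θ p s a ρ (α, β) := by
  simp only [emono, epow_add, epow_sq]
  ring

theorem emono_mono {ρ r : ℝ} (h : ρ ≤ r) (x : MI × MI) :
    emono θ p s a ρ x ≤ emono θ p s a r x := by
  have : ∀ j, eradius θ p s a ρ j ≤ eradius θ p s a r j := fun j =>
    ENNReal.ofReal_le_ofReal (div_le_div_of_nonneg_right h (weight_pos θ p s a j).le)
  exact mul_le_mul' (epow_mono this _) (epow_mono this _)

theorem mono_add (u : ℤ → ℂ) (m α β : MI) :
    mono u (m + α) (m + β) = mpow (fun j => ((‖u j‖ ^ 2 : ℝ) : ℂ)) m * mono u α β := by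
  have h : mpow (fun j => ((‖u j‖ ^ 2 : ℝ) : ℂ)) m =
      mpow u m * mpow (fun j => (starRingEnd ℂ) (u j)) m := by
    simp only [mpow, Finsupp.prod, ← Finset.prod_mul_distrib, ← mul_pow, Complex.mul_conj']
    push_cast
    rfl
  rw [mono, mono, mpow_add, mpow_add, h]
  ring

/-! ### Replacing the powers of the actions -/

/-- The power series of `u ↦ ∑ H_{m+α,m+β} A_m(|u|²) u^α ū^β`: in each term of `H` the power
`|u|^{2m}` of the actions is replaced by the polynomial `A_m(|u|²)`, and the result is expanded. -/
def Ser.transform (A : MI → MvPolynomial ℤ ℝ) (H : Ser) : Ser := fun α β =>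
  ∑' m : MI, H (m + (α - α ⊓ β)) (m + (β - α ⊓ β)) * (((A m).coeff (α ⊓ β) : ℝ) : ℂ)

/-- The sum `∑ H_{m+α,m+β} B_m u^α ū^β`: in each term of `H` the power `|u|^{2m}` of the actions
is replaced by the number `B_m`. -/
def Ser.subst (H : Ser) (B : MI → ℂ) (u : ℤ → ℂ) : ℂ :=
  ∑' x : MI × MI, H x.1 x.2 *
    (B (x.1 ⊓ x.2) * mono u (x.1 - x.1 ⊓ x.2) (x.2 - x.1 ⊓ x.2))

theorem transform_add (A : MI → MvPolynomial ℤ ℝ) (H : Ser) (l : MI) (d : DisjointPair) :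
    H.transform A (l + d.1.1) (l + d.1.2) =
      ∑' m : MI, H (m + d.1.1) (m + d.1.2) * (((A m).coeff l : ℝ) : ℂ) := by
  simp only [Ser.transform, add_inf_add, add_tsub_cancel_left]

theorem enorm_ofReal_complex (x : ℝ) : ‖(x : ℂ)‖ₑ = ‖x‖ₑ := by
  rw [← ofReal_norm, Complex.norm_real, ofReal_norm]

theorem majSum_eq_tsum_split (ρ : ℝ) (φ : MI × MI → ℝ≥0∞) (H : Ser) :
    majSum θ p s a ρ φ H = ∑' (d : DisjointPair) (m : MI), ‖H (m + d.1.1) (m + d.1.2)‖ₑ *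
      (φ (m + d.1.1, m + d.1.2) *
        (epow (fun j => eradius θ p s a ρ j ^ 2) m * emono θ p s a ρ d.1)) := by
  rw [majSum, ← splitEquiv.tsum_eq, ENNReal.tsum_prod', ENNReal.tsum_comm]
  simp only [splitEquiv_apply, emono_add]

/-- If the polynomials `A_m` are bounded by `K r^{2m}` on the polydisc of radius `ρ`, then the
transform maps series on the ball of radius `r` to series on the ball of radius `ρ`. -/
theorem majSum_transform_le {ρ r : ℝ} (hρr : ρ ≤ r) {A : MI → MvPolynomial ℤ ℝ} {K : ℝ≥0∞}
    {φ : MI × MI → ℝ≥0∞}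
    (hφ : ∀ m l α β, (A m).coeff l ≠ 0 → φ (l + α, l + β) ≤ φ (m + α, m + β))
    (hA : ∀ m, polyNorm (fun j => eradius θ p s a ρ j ^ 2) (A m) ≤
      K * epow (fun j => eradius θ p s a r j ^ 2) m) (H : Ser) :
    majSum θ p s a ρ φ (H.transform A) ≤ K * majSum θ p s a r φ H := by
  rw [majSum_eq_tsum_split, majSum_eq_tsum_split, ← ENNReal.tsum_mul_left]
  refine ENNReal.tsum_le_tsum fun d => ?_
  have h1 : ∀ l, ‖H.transform A (l + d.1.1) (l + d.1.2)‖ₑ ≤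
      ∑' m, ‖H (m + d.1.1) (m + d.1.2)‖ₑ * ‖(A m).coeff l‖ₑ := by
    intro l
    rw [transform_add]
    refine enorm_tsum_le_tsum_enorm.trans (le_of_eq (tsum_congr fun m => ?_))
    rw [enorm_mul, enorm_ofReal_complex]
  calc _ ≤ ∑' (l : MI) (m : MI), ‖H (m + d.1.1) (m + d.1.2)‖ₑ * ‖(A m).coeff l‖ₑ *
        (φ (m + d.1.1, m + d.1.2) *
          (epow (fun j => eradius θ p s a ρ j ^ 2) l * emono θ p s a ρ d.1)) := by
        refine ENNReal.tsum_le_tsum fun l => (mul_le_mul_left (h1 l) _).trans ?_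
        rw [← ENNReal.tsum_mul_right]
        refine ENNReal.tsum_le_tsum fun m => ?_
        by_cases h : (A m).coeff l = 0
        · simp [h]
        · gcongr
          exact hφ m l _ _ h
    _ = ∑' m : MI, ‖H (m + d.1.1) (m + d.1.2)‖ₑ * φ (m + d.1.1, m + d.1.2) *
          emono θ p s a ρ d.1 * polyNorm (fun j => eradius θ p s a ρ j ^ 2) (A m) := by
        rw [ENNReal.tsum_comm]
        refine tsum_congr fun m => ?_
        rw [polyNorm, wsum, ← ENNReal.tsum_mul_left]
        exact tsum_congr fun l => by ring
    _ ≤ _ := by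
        rw [← ENNReal.tsum_mul_left]
        refine ENNReal.tsum_le_tsum fun m => ?_
        calc _ ≤ ‖H (m + d.1.1) (m + d.1.2)‖ₑ * φ (m + d.1.1, m + d.1.2) * emono θ p s a r d.1 *
              (K * epow (fun j => eradius θ p s a r j ^ 2) m) := by
              gcongr
              · exact emono_mono hρr _
              · exact hA m
          _ = _ := by ring

/-- If `B_m ≤ K r^{2m}`, replacing `|u|^{2m}` by `B_m` in the terms of `H` costs at most the
factor `K`. -/
theorem tsum_enorm_subst_le {r : ℝ} {H : Ser} {B : MI → ℝ≥0∞} {K : ℝ≥0∞} {u : ℤ → ℂ}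
    (hu : ∀ j, ‖u j‖ₑ ≤ eradius θ p s a r j)
    (hB : ∀ m, B m ≤ K * epow (fun j => eradius θ p s a r j ^ 2) m) :
    ∑' x : MI × MI, ‖H x.1 x.2‖ₑ * (B (x.1 ⊓ x.2) *
      ‖mono u (x.1 - x.1 ⊓ x.2) (x.2 - x.1 ⊓ x.2)‖ₑ) ≤ K * majSum θ p s a r (fun _ => 1) H := by
  rw [majSum, ← ENNReal.tsum_mul_left]
  refine ENNReal.tsum_le_tsum fun x => ?_
  have h : emono θ p s a r x = epow (fun j => eradius θ p s a r j ^ 2) (x.1 ⊓ x.2) *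
      emono θ p s a r (x.1 - x.1 ⊓ x.2, x.2 - x.1 ⊓ x.2) := by
    rw [← emono_add, add_tsub_cancel_of_le inf_le_left, add_tsub_cancel_of_le inf_le_right]
  have h2 := enorm_mono_le hu (x.1 - x.1 ⊓ x.2, x.2 - x.1 ⊓ x.2)
  calc _ ≤ ‖H x.1 x.2‖ₑ * ((K * epow (fun j => eradius θ p s a r j ^ 2) (x.1 ⊓ x.2)) *
        emono θ p s a r (x.1 - x.1 ⊓ x.2, x.2 - x.1 ⊓ x.2)) := by
        gcongr
        exact hB _
    _ = _ := by rw [h]; ring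

theorem summable_subst {r : ℝ} {H : Ser} {B : MI → ℂ} {K : ℝ≥0∞} {u : ℤ → ℂ} (hK : K ≠ ∞)
    (hH : majSum θ p s a r (fun _ => 1) H ≠ ∞) (hu : ∀ j, ‖u j‖ₑ ≤ eradius θ p s a r j)
    (hB : ∀ m, ‖B m‖ₑ ≤ K * epow (fun j => eradius θ p s a r j ^ 2) m) :
    Summable fun x : MI × MI => H x.1 x.2 *
      (B (x.1 ⊓ x.2) * mono u (x.1 - x.1 ⊓ x.2) (x.2 - x.1 ⊓ x.2)) := by
  refine (summable_norm_of_tsum_enorm_ne_top ?_).of_norm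
  simp only [enorm_mul]
  exact ne_top_of_le_ne_top (ENNReal.mul_ne_top hK hH)
    (tsum_enorm_subst_le (B := fun m => ‖B m‖ₑ) hu hB)

theorem enorm_sq_le {u : ℤ → ℂ} {r : ℝ} (hu : ∀ j, ‖u j‖ₑ ≤ eradius θ p s a r j) (j : ℤ) :
    ‖((‖u j‖ ^ 2 : ℝ) : ℂ)‖ₑ ≤ eradius θ p s a r j ^ 2 := by
  rw [enorm_ofReal_complex, enorm_pow, enorm_norm]
  exact pow_le_pow_left' (hu j) 2

theorem aeval_eq_tsum (w : ℤ → ℂ) (f : MvPolynomial ℤ ℝ) :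
    MvPolynomial.aeval w f = ∑' l : MI, ((f.coeff l : ℝ) : ℂ) * mpow w l := by
  rw [tsum_eq_sum (s := f.support) fun l hl => by
    rw [MvPolynomial.notMem_support_iff.mp hl, Complex.ofReal_zero, zero_mul],
    MvPolynomial.aeval_def, MvPolynomial.eval₂_eq]
  rfl

/-- The transform is the expansion of the substituted series: all sums may be interchanged. -/
theorem eval_transform {r : ℝ} {H : Ser} {A : MI → MvPolynomial ℤ ℝ} {K : ℝ≥0∞} (hK : K ≠ ∞)
    (hH : majSum θ p s a r (fun _ => 1) H ≠ ∞)
    (hA : ∀ m, polyNorm (fun j => eradius θ p s a r j ^ 2) (A m) ≤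
      K * epow (fun j => eradius θ p s a r j ^ 2) m) {u : ℤ → ℂ}
    (hu : ∀ j, ‖u j‖ₑ ≤ eradius θ p s a r j) :
    (H.transform A).eval u =
      H.subst (fun m => MvPolynomial.aeval (fun j => ((‖u j‖ ^ 2 : ℝ) : ℂ)) (A m)) u := by
  set w : ℤ → ℂ := fun j => ((‖u j‖ ^ 2 : ℝ) : ℂ) with hw
  set F : (DisjointPair × MI) × MI → ℂ := fun y => H (y.1.2 + y.1.1.1.1) (y.1.2 + y.1.1.1.2) *
    (((A y.1.2).coeff y.2 : ℝ) : ℂ) * (mpow w y.2 * mono u y.1.1.1.1 y.1.1.1.2) with hF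
  have hsum : Summable F := by
    refine (summable_norm_of_tsum_enorm_ne_top ?_).of_norm
    refine ne_top_of_le_ne_top (ENNReal.mul_ne_top hK hH) ?_
    refine le_trans (le_of_eq ?_) (tsum_enorm_subst_le (θ := θ) (p := p) (s := s) (a := a)
      (r := r) (H := H) (u := u) (B := fun m => polyNorm (fun j => ‖w j‖ₑ) (A m)) hu fun m => ?_)
    · rw [ENNReal.tsum_prod', ENNReal.tsum_prod', ENNReal.tsum_comm,
        ← splitEquiv.tsum_eq fun x : MI × MI => _, ENNReal.tsum_prod']
      refine tsum_congr fun m => tsum_congr fun d => ?_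
      rw [splitEquiv_apply]
      simp only [add_inf_add, add_tsub_cancel_left, hF]
      rw [polyNorm, wsum, ← ENNReal.tsum_mul_right, ← ENNReal.tsum_mul_left]
      refine tsum_congr fun l => ?_
      rw [enorm_mul, enorm_mul, enorm_mul, enorm_mpow, enorm_ofReal_complex]
      ring
    · refine le_trans (ENNReal.tsum_le_tsum fun l => ?_) (hA m)
      exact mul_le_mul_right (epow_mono (enorm_sq_le hu) l) _
  have hr : ∑' y, F y = H.subst (fun m => MvPolynomial.aeval w (A m)) u := by
    rw [hsum.tsum_prod, Ser.subst, ← splitEquiv.tsum_eq fun x : MI × MI => _,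
      ← (Equiv.prodComm DisjointPair MI).tsum_eq]
    refine tsum_congr fun y => ?_
    obtain ⟨d, m⟩ := y
    rw [Equiv.prodComm_apply, Prod.swap_prod_mk, splitEquiv_apply]
    simp only [add_inf_add, add_tsub_cancel_left, hF, aeval_eq_tsum]
    rw [← tsum_mul_right, ← tsum_mul_left]
    exact tsum_congr fun l => by ring
  have hl : ∑' y, F y = (H.transform A).eval u := by
    -- `e` exchanges the summation index `m` of `H` with the index `l` of the expanded monomial
    set e : (DisjointPair × MI) × MI ≃ (DisjointPair × MI) × MI :=
      ⟨fun y => ((y.1.1, y.2), y.1.2), fun y => ((y.1.1, y.2), y.1.2), fun _ => rfl, fun _ => rfl⟩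
    rw [← e.tsum_eq, Summable.tsum_prod (f := fun y => F (e y))
      ((e.summable_iff (f := F)).mpr hsum),
      Ser.eval,
      ← splitEquiv.tsum_eq fun x : MI × MI => _, ← (Equiv.prodComm DisjointPair MI).tsum_eq]
    refine tsum_congr fun y => ?_
    obtain ⟨d, l⟩ := y
    rw [Equiv.prodComm_apply, Prod.swap_prod_mk, splitEquiv_apply, transform_add, mono_add,
      ← tsum_mul_right]
    rfl
  rw [← hl, hr]

/-- The sums that define the coefficients of the transform converge. -/
theorem summable_transform {ρ r : ℝ} (hρ : 0 < ρ) (hr : 0 < r) {H : Ser}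
    {A : MI → MvPolynomial ℤ ℝ} {K : ℝ≥0∞} (hK : K ≠ ∞)
    (hH : majSum θ p s a r (fun _ => 1) H ≠ ∞)
    (hA : ∀ m, polyNorm (fun j => eradius θ p s a ρ j ^ 2) (A m) ≤
      K * epow (fun j => eradius θ p s a r j ^ 2) m) (l : MI) (d : DisjointPair) :
    Summable fun m : MI => H (m + d.1.1) (m + d.1.2) * (((A m).coeff l : ℝ) : ℂ) := by
  refine (summable_norm_of_tsum_enorm_ne_top ?_).of_norm
  set c := epow (fun j => eradius θ p s a ρ j ^ 2) l * emono θ p s a r d.1 with hc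
  have hc0 : c ≠ 0 := mul_ne_zero
    (epow_ne_zero (fun j => pow_ne_zero _ (eradius_ne_zero hρ j)) _) (emono_ne_zero hr _)
  have h : (∑' m : MI, ‖H (m + d.1.1) (m + d.1.2) * (((A m).coeff l : ℝ) : ℂ)‖ₑ) * c ≤
      K * majSum θ p s a r (fun _ => 1) H := by
    rw [majSum_eq_tsum_split, ← ENNReal.tsum_mul_right]
    refine le_trans ?_ (mul_le_mul_right (ENNReal.le_tsum d) _)
    rw [← ENNReal.tsum_mul_left]
    refine ENNReal.tsum_le_tsum fun m => ?_
    rw [enorm_mul, enorm_ofReal_complex]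
    calc _ = ‖H (m + d.1.1) (m + d.1.2)‖ₑ * emono θ p s a r d.1 * (‖(A m).coeff l‖ₑ *
          epow (fun j => eradius θ p s a ρ j ^ 2) l) := by rw [hc]; ring
      _ ≤ ‖H (m + d.1.1) (m + d.1.2)‖ₑ * emono θ p s a r d.1 *
          (K * epow (fun j => eradius θ p s a r j ^ 2) m) := by
          exact mul_le_mul_right ((mul_epow_le_wsum (A m) l).trans (hA m)) _
      _ = _ := by ring
  intro htop
  rw [htop, ENNReal.top_mul hc0] at h
  exact ENNReal.mul_ne_top hK hH (top_le_iff.mp h)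

/-- Linearity of the transform; it needs convergence, since a divergent sum has the value `0`. -/
theorem transform_sub {ρ r : ℝ} (hρ : 0 < ρ) (hr : 0 < r) {H H' : Ser}
    {A : MI → MvPolynomial ℤ ℝ} {K : ℝ≥0∞} (hK : K ≠ ∞)
    (hH : majSum θ p s a r (fun _ => 1) H ≠ ∞) (hH' : majSum θ p s a r (fun _ => 1) H' ≠ ∞)
    (hA : ∀ m, polyNorm (fun j => eradius θ p s a ρ j ^ 2) (A m) ≤
      K * epow (fun j => eradius θ p s a r j ^ 2) m) :
    (H - H').transform A = H.transform A - H'.transform A := by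
  have key : ∀ x : MI × MI, (H - H').transform A x.1 x.2 =
      H.transform A x.1 x.2 - H'.transform A x.1 x.2 := by
    intro x
    obtain ⟨⟨l, d⟩, rfl⟩ := splitEquiv.surjective x
    simp only [splitEquiv_apply, transform_add]
    rw [← (summable_transform hρ hr hK hH hA l d).tsum_sub (summable_transform hρ hr hK hH' hA l d)]
    exact tsum_congr fun m => sub_mul _ _ _
  funext α β
  exact key (α, β)

theorem degree_transform {A : MI → MvPolynomial ℤ ℝ} {H : Ser}
    (h : ∀ α β, α.degree ≠ β.degree → H α β = 0) (α β : MI) (hαβ : α.degree ≠ β.degree) :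
    H.transform A α β = 0 := by
  have h1 : ∀ m : MI, H (m + (α - α ⊓ β)) (m + (β - α ⊓ β)) = 0 := by
    intro m
    refine h _ _ fun h' => hαβ ?_
    rw [map_add, map_add, add_right_inj] at h'
    have e1 := congrArg Finsupp.degree (add_tsub_cancel_of_le (inf_le_left : α ⊓ β ≤ α))
    have e2 := congrArg Finsupp.degree (add_tsub_cancel_of_le (inf_le_right : α ⊓ β ≤ β))
    rw [map_add] at e1 e2
    rw [← e1, ← e2, h']
  simp [Ser.transform, h1]

theorem conj_transform {A : MI → MvPolynomial ℤ ℝ} {H : Ser}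
    (h : ∀ α β, H α β = (starRingEnd ℂ) (H β α)) (α β : MI) :
    H.transform A α β = (starRingEnd ℂ) (H.transform A β α) := by
  rw [Ser.transform, Ser.transform, Complex.conj_tsum]
  refine tsum_congr fun m => ?_
  rw [map_mul, ← h, Complex.conj_ofReal, inf_comm β α]

/-! ### Regularity and norm of the transform -/

theorem fieldFactor_le (η : ℝ) (j : ℤ) {l m : MI} (h : l ≤ m) (α β : MI) :
    fieldFactor η j (l + α, l + β) ≤ fieldFactor η j (m + α, m + β) := by
  rw [fieldFactor, fieldFactor, momFactor_add, momFactor_add]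
  gcongr
  simpa using h j

theorem scale_mul {ρ r : ℝ} (hρ : 0 < ρ) (hr : 0 < r) (j : ℤ) :
    scale θ p s a ρ j = ENNReal.ofReal ((r / ρ) ^ 2) * scale θ p s a r j := by
  rw [scale, scale, ← ENNReal.ofReal_mul (by positivity)]
  congr 1
  field_simp

/-- The norm estimate for the transform. The derivative in `ū_j` yields a factor `l_j + β_j` in the
transform and `m_j + β_j` in `H`, where `l ≤ m`; passing from the radius `r` to `ρ` costs `(r/ρ)²`
since the vector field has one factor `u_j` less and the norm is divided by the radius. -/
theorem hamNorm_transform_le (hp : 1 < p) (hs : 0 < s) (ha : 0 ≤ a) {ρ r η : ℝ} (hρ : 0 < ρ)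
    (hr : 0 < r) (hρr : ρ ≤ r) {A : MI → MvPolynomial ℤ ℝ} {K : ℝ≥0∞}
    (hle : ∀ m l, (A m).coeff l ≠ 0 → l ≤ m)
    (hA : ∀ m, polyNorm (fun j => eradius θ p s a ρ j ^ 2) (A m) ≤
      K * epow (fun j => eradius θ p s a r j ^ 2) m) {H : Ser}
    (hH : majSum θ p s a r (momFactor η) H ≠ ∞) :
    hamNorm θ p s a ρ η (H.transform A) ≤
      ENNReal.ofReal ((r / ρ) ^ 2) * K * hamNorm θ p s a r η H := by
  refine (hamNorm_le_iSup_majSum hρ η _).trans (iSup_le fun j => ?_)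
  rw [scale_mul hρ hr]
  calc _ ≤ K * majSum θ p s a r (fieldFactor η j) H *
        (ENNReal.ofReal ((r / ρ) ^ 2) * scale θ p s a r j) := by
        gcongr
        exact majSum_transform_le hρr (fun m l α β h => fieldFactor_le η j (hle m l h) α β) hA H
    _ = ENNReal.ofReal ((r / ρ) ^ 2) * K *
        (majSum θ p s a r (fieldFactor η j) H * scale θ p s a r j) := by ring
    _ ≤ _ := by
        gcongr
        exact majSum_mul_scale_le_hamNorm hp hs ha hr hH j

theorem isMajorantAnalytic_of_majSum {r : ℝ} {H : Ser}
    (h : majSum θ p s a r (fun _ => 1) H ≠ ∞) (hreal : ∀ α β, H α β = (starRingEnd ℂ) (H β α))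
    (hmass : ∀ α β, α.degree ≠ β.degree → H α β = 0) : IsMajorantAnalytic θ p s a r H :=
  ⟨fun _ hu => summable_norm_of_tsum_enorm_ne_top (ne_top_of_le_ne_top h
    (tsum_enorm_mul_mono_le (fun j => W.enorm_apply_le_eradius hu j) H)), hreal, hmass⟩

theorem majSum_momFactor_ne_top (hp : 1 < p) (hs : 0 < s) (ha : 0 ≤ a) {r η : ℝ} (hr : 0 < r)
    {H : Ser} (h : IsRegular θ p s a r η H) : majSum θ p s a r (momFactor η) H ≠ ∞ := by
  rw [← majSum_majorant]
  exact majSum_ne_top_of_isMajorantAnalytic hp hs ha hr h.majorant_analytic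

theorem isRegular_transform (hp : 1 < p) (hs : 0 < s) (ha : 0 ≤ a) {r η : ℝ} (hr : 0 < r)
    (hη : 0 ≤ η) {A : MI → MvPolynomial ℤ ℝ} {K : ℝ≥0∞} (hK : K ≠ ∞)
    (hle : ∀ m l, (A m).coeff l ≠ 0 → l ≤ m)
    (hA : ∀ m, polyNorm (fun j => eradius θ p s a r j ^ 2) (A m) ≤
      K * epow (fun j => eradius θ p s a r j ^ 2) m) {H : Ser} (hH : IsRegular θ p s a r η H) :
    IsRegular θ p s a r η (H.transform A) := by
  have hH' := majSum_momFactor_ne_top hp hs ha hr hH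
  have h1 : majSum θ p s a r (momFactor η) (H.transform A) ≠ ∞ :=
    ne_top_of_le_ne_top (ENNReal.mul_ne_top hK hH') (majSum_transform_le le_rfl
      (fun m l α β _ => by rw [momFactor_add, momFactor_add]) hA H)
  have hreal := conj_transform (A := A) hH.analytic.real
  have hmass := degree_transform (A := A) hH.analytic.mass
  refine ⟨isMajorantAnalytic_of_majSum
    (ne_top_of_le_ne_top h1 (majSum_mono (one_le_momFactor hη) _)) hreal hmass,
    isMajorantAnalytic_of_majSum (by rwa [majSum_majorant]) (fun α β => ?_) (fun α β h => ?_), ?_⟩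
  · rw [Ser.majorant, Ser.majorant, Complex.conj_ofReal, hreal α β, Complex.norm_conj]
    congr 4
    push_cast
    exact abs_sub_comm _ _
  · rw [Ser.majorant, hmass α β h]
    simp
  · refine (hamNorm_transform_le hp hs ha hr hr le_rfl hle hA hH').trans_lt ?_
    exact ENNReal.mul_lt_top (ENNReal.mul_lt_top ENNReal.ofReal_lt_top hK.lt_top) hH.bounded

/-! ### Analyticity of sums of products of linear functionals -/

section Analytic

variable {𝕜 E A X : Type*} [NontriviallyNormedField 𝕜] [NormedAddCommGroup E] [NormedSpace 𝕜 E]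
  [NormedCommRing A] [NormedAlgebra 𝕜 A]

/-- The power series at the origin of `u ↦ c ∏ ℓ(u)`, the product being over the list `L`. -/
def prodSeries (c : A) (L : List (E →L[𝕜] A)) : FormalMultilinearSeries 𝕜 E A := fun n =>
  if h : L.length = n then
    (ContinuousLinearMap.mul 𝕜 A c).compContinuousMultilinearMap
      ((ContinuousMultilinearMap.mkPiAlgebraFin 𝕜 n A).compContinuousLinearMap
        fun i => L.get (Fin.cast h.symm i))
  else 0

theorem prodSeries_apply_of_ne (c : A) (L : List (E →L[𝕜] A)) {n : ℕ} (h : L.length ≠ n) :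
    prodSeries c L n = 0 := dif_neg h

theorem prodSeries_apply_length (c : A) (L : List (E →L[𝕜] A)) (u : E) :
    prodSeries c L L.length (fun _ => u) = c * (L.map fun ℓ => ℓ u).prod := by
  rw [prodSeries, dif_pos rfl]
  simp only [ContinuousLinearMap.compContinuousMultilinearMap_coe, Function.comp_apply,
    ContinuousMultilinearMap.compContinuousLinearMap_apply,
    ContinuousMultilinearMap.mkPiAlgebraFin_apply, ContinuousLinearMap.mul_apply']
  congr 2
  simpa using List.ofFn_getElem_eq_map L fun ℓ => ℓ u

variable [NormOneClass A]

theorem norm_prodSeries_le (c : A) (L : List (E →L[𝕜] A)) (ρ : ℝ) (hρ : 0 ≤ ρ) (n : ℕ) :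
    ‖prodSeries c L n‖ * ρ ^ n ≤
      if L.length = n then ‖c‖ * (L.map fun ℓ => ‖ℓ‖ * ρ).prod else 0 := by
  split_ifs with h
  · subst h
    have h1 : ‖prodSeries c L L.length‖ ≤ ‖c‖ * ∏ i, ‖L.get i‖ := by
      rw [prodSeries, dif_pos rfl]
      refine (ContinuousLinearMap.norm_compContinuousMultilinearMap_le _ _).trans ?_
      refine mul_le_mul (ContinuousLinearMap.opNorm_mul_apply_le 𝕜 A c) ?_ (norm_nonneg _)
        (norm_nonneg _)
      refine (ContinuousMultilinearMap.norm_compContinuousLinearMap_le _ _).trans ?_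
      rw [ContinuousMultilinearMap.norm_mkPiAlgebraFin, one_mul]
      rfl
    have h2 : (∏ i, ‖L.get i‖) * ρ ^ L.length = (L.map fun ℓ => ‖ℓ‖ * ρ).prod := by
      rw [← List.ofFn_getElem_eq_map, List.prod_ofFn, Finset.prod_mul_distrib]
      simp
    calc _ ≤ ‖c‖ * (∏ i, ‖L.get i‖) * ρ ^ L.length := by gcongr
      _ = _ := by rw [mul_assoc, h2]
  · rw [prodSeries_apply_of_ne c L h, norm_zero, zero_mul]

/-- A sum of products of continuous linear functionals is analytic in a ball on which the products
of the norms are summable: the terms of equal degree are collected to a power series at `0`. -/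
theorem analyticOnNhd_tsum_prod [CompleteSpace A] {c : X → A} {L : X → List (E →L[𝕜] A)}
    {ρ : ℝ} (hρ : 0 < ρ)
    (h : Summable fun x => ‖c x‖ * ((L x).map fun ℓ => ‖ℓ‖ * ρ).prod) :
    AnalyticOnNhd 𝕜 (fun u : E => ∑' x, c x * ((L x).map fun ℓ => ℓ u).prod)
      (Metric.ball 0 ρ) := by
  set b : X → ℝ := fun x => ‖c x‖ * ((L x).map fun ℓ => ‖ℓ‖ * ρ).prod with hb
  have hs : Summable fun y : X × ℕ => if (L y.1).length = y.2 then b y.1 else 0 := by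
    have hinj : Function.Injective fun x : X => (x, (L x).length) := fun x y hxy =>
      (Prod.mk.inj hxy).1
    rw [← hinj.summable_iff]
    · simpa [Function.comp_def] using h
    · rintro ⟨x, n⟩ hx
      refine if_neg fun h' => hx ⟨x, ?_⟩
      exact Prod.ext rfl h'
  have hs' : Summable fun y : X × ℕ => ‖prodSeries (c y.1) (L y.1) y.2‖ * ρ ^ y.2 :=
    Summable.of_nonneg_of_le (fun y => by positivity)
      (fun y => norm_prodSeries_le _ _ ρ hρ.le _) hs
  have hn : ∀ n, Summable fun x => ‖prodSeries (c x) (L x) n‖ := fun n => by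
    have h1 : Summable fun x => ‖prodSeries (c x) (L x) n‖ * ρ ^ n :=
      hs'.comp_injective (i := fun x : X => (x, n)) fun x y hxy => (Prod.mk.inj hxy).1
    rwa [summable_mul_right_iff (pow_ne_zero n hρ.ne')] at h1
  set P : FormalMultilinearSeries 𝕜 E A := fun n => ∑' x, prodSeries (c x) (L x) n with hP
  have hrad : ENNReal.ofReal ρ ≤ P.radius := by
    refine P.le_radius_of_summable_norm (r := ρ.toNNReal) ?_
    rw [Real.coe_toNNReal ρ hρ.le]
    have h2 : Summable fun n : ℕ => ∑' x, ‖prodSeries (c x) (L x) n‖ * ρ ^ n :=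
      hs'.prod_symm.prod
    refine Summable.of_nonneg_of_le (fun n => by positivity) (fun n => ?_) h2
    rw [tsum_mul_right]
    gcongr
    exact norm_tsum_le_tsum_norm (hn n)
  have hps : HasFPowerSeriesOnBall (fun u : E => ∑' x, c x * ((L x).map fun ℓ => ℓ u).prod) P 0
      (ENNReal.ofReal ρ) := by
    refine ⟨hrad, ENNReal.ofReal_pos.mpr hρ, fun {u} hu => ?_⟩
    have hu' : ‖u‖ ≤ ρ := by
      rw [Metric.eball_ofReal, mem_ball_zero_iff] at hu
      exact hu.le
    have hF : Summable fun y : X × ℕ => prodSeries (c y.1) (L y.1) y.2 fun _ => u := by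
      refine Summable.of_norm_bounded hs' fun y => ?_
      refine (ContinuousMultilinearMap.le_opNorm _ _).trans ?_
      rw [Finset.prod_const, Finset.card_univ, Fintype.card_fin]
      gcongr
    have hx : ∀ x, HasSum (fun n => prodSeries (c x) (L x) n fun _ => u)
        (c x * ((L x).map fun ℓ => ℓ u).prod) := fun x => by
      rw [← prodSeries_apply_length]
      refine hasSum_single _ fun n hn => ?_
      rw [prodSeries_apply_of_ne _ _ (Ne.symm hn)]
      rfl
    have hPn : ∀ n, HasSum (fun x => prodSeries (c x) (L x) n fun _ => u) (P n fun _ => u) :=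
      fun n => ContinuousMultilinearMap.hasSum_eval ((hn n).of_norm.hasSum) _
    have htot : ∑' x, c x * ((L x).map fun ℓ => ℓ u).prod =
        ∑' y : X × ℕ, prodSeries (c y.1) (L y.1) y.2 fun _ => u :=
      (hF.hasSum.prod_fiberwise hx).tsum_eq
    rw [zero_add, htot]
    have := ((Equiv.prodComm ℕ X).hasSum_iff.mpr hF.hasSum).prod_fiberwise hPn
    exact this
  have := hps.analyticOnNhd
  rwa [Metric.eball_ofReal] at this

end Analytic


/-! ### Coordinates as continuous functionals -/

/-- The coordinate `u ↦ u_j`, of norm at most `1 / weight j`. -/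
def coordL (θ p s a : ℝ) (j : ℤ) : W θ p s a →L[ℂ] ℂ :=
  LinearMap.mkContinuous
    ⟨⟨fun u => u j, fun u v => W.add_apply u v j⟩, fun c u => W.smul_apply c u j⟩
    (weight θ p s a j)⁻¹ fun u => by
      have h := W.norm_apply_le_radius (le_refl ‖u‖) j
      rwa [radius, div_eq_inv_mul] at h

theorem norm_coordL_le (j : ℤ) : ‖coordL θ p s a j‖ ≤ (weight θ p s a j)⁻¹ :=
  LinearMap.mkContinuous_norm_le _ (inv_nonneg.mpr (weight_pos θ p s a j).le) _

theorem enorm_coordL_mul_le {ρ : ℝ} (hρ : 0 ≤ ρ) (j : ℤ) :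
    ‖‖coordL θ p s a j‖ * ρ‖ₑ ≤ eradius θ p s a ρ j := by
  rw [← ofReal_norm, eradius, radius, div_eq_inv_mul, Real.norm_of_nonneg (by positivity)]
  exact ENNReal.ofReal_le_ofReal (mul_le_mul_of_nonneg_right (norm_coordL_le j) hρ)

/-- The list of indices of a multi-index, with multiplicity. -/
def MI.toList (m : MI) : List ℤ := (Finsupp.toMultiset m).toList

theorem MI.prod_map_toList {M : Type*} [CommMonoid M] (m : MI) (f : ℤ → M) :
    (m.toList.map f).prod = m.prod fun j n => f j ^ n := by
  rw [← Multiset.prod_coe, ← Multiset.map_coe, MI.toList, Multiset.coe_toList,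
    Finsupp.toMultiset_map, Finsupp.prod_toMultiset, Finsupp.prod_mapDomain_index (by simp)
    (fun _ _ _ => pow_add _ _ _)]

theorem enorm_prod_le_epow {W : ℤ → ℝ≥0∞} {f : ℤ → ℝ} (h : ∀ j, ‖f j‖ₑ ≤ W j) (m : MI) :
    ‖(m.toList.map f).prod‖ₑ ≤ epow W m := by
  rw [MI.prod_map_toList, epow]
  simp only [Finsupp.prod, enorm_eq_nnnorm, nnnorm_prod, nnnorm_pow,
    ENNReal.ofNNReal_finsetProd, ENNReal.coe_pow]
  exact Finset.prod_le_prod' fun j _ => pow_le_pow_left' (h j) _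

theorem summable_of_tsum_enorm_le {ι : Type*} {f : ι → ℝ} {g : ι → ℝ≥0∞}
    (h : ∀ i, ‖f i‖ₑ ≤ g i) (hg : ∑' i, g i ≠ ∞) : Summable f := by
  have := ENNReal.summable_toReal (ne_top_of_le_ne_top hg (ENNReal.tsum_le_tsum h))
  refine Summable.of_norm ?_
  simpa using this

/-- A series that converges absolutely at the extremal sequence is analytic in the ball, as a
function of the real variable `u`. -/
theorem analyticOnNhd_eval {r : ℝ} (hr : 0 < r) {G : Ser}
    (hG : majSum θ p s a r (fun _ => 1) G ≠ ∞) :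
    AnalyticOnNhd ℝ (fun u : W θ p s a => G.eval u) (Metric.ball 0 r) := by
  set f : ℤ → W θ p s a →L[ℝ] ℂ := fun j => (coordL θ p s a j).restrictScalars ℝ with hf
  set g : ℤ → W θ p s a →L[ℝ] ℂ := fun j => (Complex.conjCLE : ℂ →L[ℝ] ℂ).comp (f j) with hg
  have hfn : ∀ j, ‖‖f j‖ * r‖ₑ ≤ eradius θ p s a r j := fun j => by
    rw [hf, ContinuousLinearMap.norm_restrictScalars]
    exact enorm_coordL_mul_le hr.le j
  have hgn : ∀ j, ‖‖g j‖ * r‖ₑ ≤ eradius θ p s a r j := fun j => by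
    have h1 : ‖g j‖ ≤ ‖f j‖ := by
      refine ContinuousLinearMap.opNorm_le_bound _ (norm_nonneg _) fun u => ?_
      refine le_trans (le_of_eq ?_) ((f j).le_opNorm u)
      exact Complex.norm_conj _
    refine le_trans ?_ (hfn j)
    rw [← ofReal_norm, ← ofReal_norm, Real.norm_of_nonneg (by positivity),
      Real.norm_of_nonneg (by positivity)]
    exact ENNReal.ofReal_le_ofReal (mul_le_mul_of_nonneg_right h1 hr.le)
  have key := analyticOnNhd_tsum_prod (c := fun x : MI × MI => G x.1 x.2)
    (L := fun x => x.1.toList.map f ++ x.2.toList.map g) hr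
    (summable_of_tsum_enorm_le (fun x => ?_) hG)
  · have e : (fun u : W θ p s a => G.eval u) = fun u => ∑' x : MI × MI, G x.1 x.2 *
        ((x.1.toList.map f ++ x.2.toList.map g).map fun ℓ => ℓ u).prod := by
      funext u
      refine tsum_congr fun x => ?_
      rw [List.map_append, List.prod_append, List.map_map, List.map_map, MI.prod_map_toList,
        MI.prod_map_toList]
      rfl
    rw [e]
    exact key
  · rw [enorm_mul, enorm_norm, List.map_append, List.prod_append, List.map_map, List.map_map,
      enorm_mul, one_mul, emono]
    exact mul_le_mul_right (mul_le_mul' (enorm_prod_le_epow hfn x.1) (enorm_prod_le_epow hgn x.2)) _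

theorem eradius_two {r : ℝ} (hr : 0 < r) (j : ℤ) :
    eradius θ (2 * p) (2 * s) (2 * a) (r ^ 2) j = eradius θ p s a r j ^ 2 := by
  rw [eradius, eradius, ← ENNReal.ofReal_pow (radius_pos hr j).le, radius, radius, weight_two,
    div_pow]

/-- The lifted function is analytic in the actions on the ball of radius `r²`. -/
theorem analyticOnNhd_lift {r : ℝ} (hr : 0 < r) {H : Ser}
    (hH : majSum θ p s a r (fun _ => 1) H ≠ ∞) {u : ℤ → ℂ}
    (hu : ∀ j, ‖u j‖ₑ ≤ eradius θ p s a r j) :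
    AnalyticOnNhd ℂ (fun w : W θ (2 * p) (2 * s) (2 * a) => H.lift u w)
      (Metric.ball 0 (r ^ 2)) := by
  set f : ℤ → W θ (2 * p) (2 * s) (2 * a) →L[ℂ] ℂ := coordL θ (2 * p) (2 * s) (2 * a) with hf
  have hfn : ∀ j, ‖‖f j‖ * r ^ 2‖ₑ ≤ eradius θ p s a r j ^ 2 := fun j => by
    rw [← eradius_two hr]
    exact enorm_coordL_mul_le (by positivity) j
  have hB := tsum_enorm_subst_le (H := H) (K := 1) (B := epow fun j => eradius θ p s a r j ^ 2) hu
    fun m => by rw [one_mul]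
  rw [one_mul] at hB
  have key := analyticOnNhd_tsum_prod (c := fun x : MI × MI => H x.1 x.2 *
    mono u (x.1 - x.1 ⊓ x.2) (x.2 - x.1 ⊓ x.2))
    (L := fun x => (x.1 ⊓ x.2).toList.map f) (pow_pos hr 2)
    (summable_of_tsum_enorm_le (fun x => ?_) (ne_top_of_le_ne_top hH hB))
  · have e : (fun w : W θ (2 * p) (2 * s) (2 * a) => H.lift u w) = fun w => ∑' x : MI × MI,
        H x.1 x.2 * mono u (x.1 - x.1 ⊓ x.2) (x.2 - x.1 ⊓ x.2) *
          (((x.1 ⊓ x.2).toList.map f).map fun ℓ => ℓ w).prod := by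
      funext w
      refine tsum_congr fun x => ?_
      rw [List.map_map, MI.prod_map_toList, mul_comm (mpow _ _), ← mul_assoc]
      rfl
    rw [e]
    exact key
  · rw [enorm_mul, enorm_norm, enorm_mul, List.map_map, mul_assoc, mul_comm ‖mono _ _ _‖ₑ]
    exact mul_le_mul_right (mul_le_mul_left (enorm_prod_le_epow hfn _) _) _

/-! ### Power series along a line -/

/-- The coefficients of a power series in one variable are determined by its sum near `0`. -/
theorem coeff_unique_of_hasSum_pow {𝕜 F : Type*} [NontriviallyNormedField 𝕜]
    [NormedAddCommGroup F] [NormedSpace 𝕜 F] {g : 𝕜 → F} {b c : ℕ → F}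
    (hb : ∀ᶠ t : 𝕜 in nhds 0, HasSum (fun n => t ^ n • b n) (g t))
    (hc : ∀ᶠ t : 𝕜 in nhds 0, HasSum (fun n => t ^ n • c n) (g t)) : b = c := by
  have key : ∀ b : ℕ → F, (∀ᶠ t : 𝕜 in nhds 0, HasSum (fun n => t ^ n • b n) (g t)) →
      ∃ P : FormalMultilinearSeries 𝕜 𝕜 F, HasFPowerSeriesAt g P 0 ∧ ∀ n, P.coeff n = b n := by
    intro b hb
    set P : FormalMultilinearSeries 𝕜 𝕜 F := fun n =>
      ContinuousMultilinearMap.mkPiRing 𝕜 (Fin n) (b n) with hP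
    have hco : ∀ n, P.coeff n = b n := fun n => by
      simp [hP, FormalMultilinearSeries.coeff, ContinuousMultilinearMap.mkPiRing_apply]
    refine ⟨P, ?_, hco⟩
    rw [hasFPowerSeriesAt_iff]
    filter_upwards [hb] with t ht
    simpa only [hco, zero_add] using ht
  obtain ⟨P, hP, hPb⟩ := key b hb
  obtain ⟨Q, hQ, hQc⟩ := key c hc
  funext n
  rw [← hPb, ← hQc, hP.eq_formalMultilinearSeries hQ]

/-- A power series along a line through the centre determines the iterated derivative in the
direction of the line. -/
theorem iteratedFDeriv_eq_of_hasSum_line {E : Type*} [NormedAddCommGroup E] [NormedSpace ℂ E]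
    {f : E → ℂ} {x v : E} (hf : AnalyticAt ℂ f x) {c : ℕ → ℂ}
    (hc : ∀ᶠ t : ℂ in nhds 0, HasSum (fun n => t ^ n * c n) (f (x + t • v))) (n : ℕ) :
    iteratedFDeriv ℂ n f x (fun _ => v) = n.factorial * c n := by
  obtain ⟨P, ρ, hP⟩ := hf
  have h1 := hP.hasFPowerSeriesAt.eventually_hasSum
  have hv : Filter.Tendsto (fun t : ℂ => t • v) (nhds 0) (nhds 0) := by
    have : Continuous fun t : ℂ => t • v := continuous_id.smul continuous_const
    simpa using this.tendsto 0
  have h2 : ∀ᶠ t : ℂ in nhds 0, HasSum (fun k => t ^ k • P k fun _ => v) (f (x + t • v)) := by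
    filter_upwards [hv.eventually h1] with t ht
    have e : (fun k => t ^ k • P k fun _ => v) = fun k => P k fun _ => t • v := by
      funext k
      have := (P k).map_smul_univ (fun _ => t) (fun _ => v)
      rw [Finset.prod_const, Finset.card_univ, Fintype.card_fin] at this
      exact this.symm
    rw [e]
    exact ht
  have h3 := congrFun (coeff_unique_of_hasSum_pow h2 hc) n
  rw [← hP.factorial_smul v n, h3, nsmul_eq_mul]

/-! ### Families of Hamiltonians -/

section Family

variable {ρ r η : ℝ} {A : MI → MvPolynomial ℤ ℝ} {K : ℝ≥0∞} {O : Set (ℤ → ℝ)}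
  {H : (ℤ → ℝ) → Ser}

theorem supNorm_transform_le (hp : 1 < p) (hs : 0 < s) (ha : 0 ≤ a) (hρ : 0 < ρ) (hr : 0 < r)
    (hρr : ρ ≤ r) (hle : ∀ m l, (A m).coeff l ≠ 0 → l ≤ m)
    (hA : ∀ m, polyNorm (fun j => eradius θ p s a ρ j ^ 2) (A m) ≤
      K * epow (fun j => eradius θ p s a r j ^ 2) m)
    (hH : IsRegularFamily θ p s a r η O H) :
    supNorm θ p s a ρ η O (fun ω => (H ω).transform A) ≤
      ENNReal.ofReal ((r / ρ) ^ 2) * K * supNorm θ p s a r η O H :=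
  iSup₂_le fun ω hω => (hamNorm_transform_le hp hs ha hρ hr hρr hle hA
    (majSum_momFactor_ne_top hp hs ha hr (hH.regular ω hω))).trans
      (mul_le_mul_right (le_iSup₂ (f := fun ω _ => hamNorm θ p s a r η (H ω)) ω hω) _)

theorem lipNorm_transform_le (hp : 1 < p) (hs : 0 < s) (ha : 0 ≤ a) (hη : 0 ≤ η) (hρ : 0 < ρ)
    (hr : 0 < r) (hρr : ρ ≤ r) (hK : K ≠ ∞) (hle : ∀ m l, (A m).coeff l ≠ 0 → l ≤ m)
    (hA : ∀ m, polyNorm (fun j => eradius θ p s a ρ j ^ 2) (A m) ≤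
      K * epow (fun j => eradius θ p s a r j ^ 2) m)
    (hH : IsRegularFamily θ p s a r η O H) :
    lipNorm θ p s a ρ η O (fun ω => (H ω).transform A) ≤
      ENNReal.ofReal ((r / ρ) ^ 2) * K * lipNorm θ p s a r η O H := by
  refine iSup₂_le fun ω hω => iSup₂_le fun ω' hω' => iSup_le fun hne => ?_
  have h1 := majSum_momFactor_ne_top hp hs ha hr (hH.regular ω hω)
  have h2 := majSum_momFactor_ne_top hp hs ha hr (hH.regular ω' hω')
  have h3 : ∀ G, majSum θ p s a r (momFactor η) G ≠ ∞ → majSum θ p s a r (fun _ => 1) G ≠ ∞ :=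
    fun G hG => ne_top_of_le_ne_top hG (majSum_mono (one_le_momFactor hη) G)
  have h4 := hamNorm_transform_le hp hs ha hρ hr hρr hle hA
    (ne_top_of_le_ne_top (ENNReal.add_ne_top.mpr ⟨h1, h2⟩) (majSum_sub_le r (momFactor η) _ _))
  rw [transform_sub hρ hr hK (h3 _ h1) (h3 _ h2) hA] at h4
  refine (ENNReal.div_le_div_right h4 _).trans ?_
  rw [mul_div_assoc]
  refine mul_le_mul_right ?_ _
  exact le_iSup₂_of_le ω hω (le_iSup₂_of_le ω' hω' (le_iSup_of_le hne le_rfl))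

theorem famNorm_transform_le (hp : 1 < p) (hs : 0 < s) (ha : 0 ≤ a) (hη : 0 ≤ η) (hρ : 0 < ρ)
    (hr : 0 < r) (hρr : ρ ≤ r) (hK : K ≠ ∞) (hle : ∀ m l, (A m).coeff l ≠ 0 → l ≤ m)
    (hA : ∀ m, polyNorm (fun j => eradius θ p s a ρ j ^ 2) (A m) ≤
      K * epow (fun j => eradius θ p s a r j ^ 2) m)
    (hH : IsRegularFamily θ p s a r η O H) (μ : ℝ≥0) :
    famNorm θ p s a ρ η μ O (fun ω => (H ω).transform A) ≤
      ENNReal.ofReal ((r / ρ) ^ 2) * K * famNorm θ p s a r η μ O H := by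
  have h1 := supNorm_transform_le hp hs ha hρ hr hρr hle hA hH
  have h2 := lipNorm_transform_le hp hs ha hη hρ hr hρr hK hle hA hH
  calc _ ≤ ENNReal.ofReal ((r / ρ) ^ 2) * K * supNorm θ p s a r η O H +
        μ * (ENNReal.ofReal ((r / ρ) ^ 2) * K * lipNorm θ p s a r η O H) := by
        unfold famNorm
        gcongr
    _ = _ := by rw [famNorm]; ring

theorem isRegularFamily_transform (hp : 1 < p) (hs : 0 < s) (ha : 0 ≤ a) (hη : 0 ≤ η)
    (hr : 0 < r) (hK : K ≠ ∞) (hle : ∀ m l, (A m).coeff l ≠ 0 → l ≤ m)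
    (hA : ∀ m, polyNorm (fun j => eradius θ p s a r j ^ 2) (A m) ≤
      K * epow (fun j => eradius θ p s a r j ^ 2) m)
    (hH : IsRegularFamily θ p s a r η O H) :
    IsRegularFamily θ p s a r η O (fun ω => (H ω).transform A) := by
  have hC : ENNReal.ofReal ((r / r) ^ 2) * K < ∞ :=
    ENNReal.mul_lt_top ENNReal.ofReal_lt_top hK.lt_top
  exact ⟨fun ω hω => isRegular_transform hp hs ha hr hη hK hle hA (hH.regular ω hω),
    (supNorm_transform_le hp hs ha hr hr le_rfl hle hA hH).trans_lt
      (ENNReal.mul_lt_top hC hH.sup_lt),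
    (lipNorm_transform_le hp hs ha hη hr hr le_rfl hK hle hA hH).trans_lt
      (ENNReal.mul_lt_top hC hH.lip_lt)⟩

end Family

/-! ### The projections as substitutions -/

theorem eval_eq_subst (H : Ser) (u : ℤ → ℂ) :
    H.eval u = H.subst (mpow fun j => ((‖u j‖ ^ 2 : ℝ) : ℂ)) u := by
  refine tsum_congr fun x => ?_
  rw [← mono_add, add_tsub_cancel_of_le inf_le_left, add_tsub_cancel_of_le inf_le_right]

theorem subst_const_mul (H : Ser) (c : ℂ) (B : MI → ℂ) (u : ℤ → ℂ) :
    H.subst (fun m => c * B m) u = c * H.subst B u := by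
  rw [Ser.subst, Ser.subst, ← tsum_mul_left]
  exact tsum_congr fun x => by ring

/-- Substitution commutes with absolutely convergent sums. -/
theorem hasSum_subst {ι : Type*} {r : ℝ} {H : Ser} {B : ι → MI → ℂ} {b : MI → ℂ} {K : ℝ≥0∞}
    {u : ℤ → ℂ} (hK : K ≠ ∞) (hH : majSum θ p s a r (fun _ => 1) H ≠ ∞)
    (hu : ∀ j, ‖u j‖ₑ ≤ eradius θ p s a r j)
    (hB : ∀ m, ∑' i, ‖B i m‖ₑ ≤ K * epow (fun j => eradius θ p s a r j ^ 2) m)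
    (hb : ∀ m, HasSum (fun i => B i m) (b m)) :
    HasSum (fun i => H.subst (B i) u) (H.subst b u) := by
  set F : (MI × MI) × ι → ℂ := fun y => H y.1.1 y.1.2 *
    (B y.2 (y.1.1 ⊓ y.1.2) * mono u (y.1.1 - y.1.1 ⊓ y.1.2) (y.1.2 - y.1.1 ⊓ y.1.2)) with hF
  have hsum : Summable F := by
    refine (summable_norm_of_tsum_enorm_ne_top ?_).of_norm
    refine ne_top_of_le_ne_top (ENNReal.mul_ne_top hK hH) ?_
    refine le_trans (le_of_eq ?_)
      (tsum_enorm_subst_le (H := H) (B := fun m => ∑' i, ‖B i m‖ₑ) hu hB)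
    rw [ENNReal.tsum_prod']
    refine tsum_congr fun x => ?_
    simp only [hF, enorm_mul]
    rw [ENNReal.tsum_mul_left, ENNReal.tsum_mul_right]
  have h1 : H.subst b u = ∑' y, F y := by
    refine (hsum.hasSum.prod_fiberwise fun x => ?_).tsum_eq
    exact ((hb (x.1 ⊓ x.2)).mul_right _).mul_left _
  have hsum' : Summable fun y : ι × (MI × MI) => F (y.2, y.1) := hsum.prod_symm
  have h2 : HasSum (fun y : ι × (MI × MI) => F (y.2, y.1)) (∑' y, F y) :=
    (Equiv.prodComm ι (MI × MI)).hasSum_iff.mpr hsum.hasSum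
  rw [h1]
  exact h2.prod_fiberwise fun i => (hsum'.prod_factor i).hasSum

theorem norm_absSq_le {u : W θ p s a} {ρ : ℝ} (hu : ‖u‖ ≤ ρ) : ‖absSq u‖ ≤ ρ ^ 2 := by
  refine ciSup_le fun j => ?_
  have h1 : ‖u j‖ * weight θ p s a j ≤ ρ := (le_ciSup u.bdd j).trans hu
  have h0 : 0 ≤ ‖u j‖ * weight θ p s a j :=
    mul_nonneg (norm_nonneg _) (weight_pos θ p s a j).le
  have h2 : ‖absSq u j‖ = ‖u j‖ ^ 2 := by
    change ‖((‖u j‖ ^ 2 : ℝ) : ℂ)‖ = _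
    rw [Complex.norm_real, norm_pow, norm_norm]
  rw [h2, weight_two, ← mul_pow]
  exact pow_le_pow_left₀ h0 h1 2

section Torus

variable {r κ : ℝ} {I : ℤ → ℝ} {sqrtI : W θ p s a}

theorem action_le (hI : ∀ j, 0 ≤ I j) (hsqrtI : ∀ j, sqrtI j = ((√(I j) : ℝ) : ℂ))
    (hIκ : ‖sqrtI‖ ≤ κ * r) (j : ℤ) : I j ≤ κ ^ 2 * radius θ p s a r j ^ 2 := by
  have h := W.norm_apply_le_radius hIκ j
  rw [hsqrtI, Complex.norm_real, Real.norm_of_nonneg (Real.sqrt_nonneg _)] at h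
  have h2 := pow_le_pow_left₀ (Real.sqrt_nonneg _) h 2
  rw [Real.sq_sqrt (hI j)] at h2
  refine h2.trans (le_of_eq ?_)
  rw [radius, radius, ← mul_pow, mul_div_assoc]

/-- The growth rate of the Taylor coefficients at the torus, from the polydisc of radius `κs r` to
that of radius `r`. -/
def taylorRate (κ κs : ℝ) : ℝ := (κs ^ 2 + κ ^ 2) / (1 - κ ^ 2)

theorem taylorRate_nonneg (hκ0 : 0 ≤ κ) (hκ : κ < 1) (κs : ℝ) : 0 ≤ taylorRate κ κs :=
  div_nonneg (by positivity) (by nlinarith)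

/-- The rate is chosen such that `κ² D + κs² + κ² = D`. -/
theorem taylorRate_condition (hI : ∀ j, 0 ≤ I j)
    (hIr : ∀ j, I j ≤ κ ^ 2 * radius θ p s a r j ^ 2) (hκ0 : 0 ≤ κ) (hκ : κ < 1) {κs : ℝ}
    (hκs : 0 < κs) (hr : 0 < r) (j : ℤ) :
    ‖I j‖ₑ * ENNReal.ofReal (taylorRate κ κs) + (eradius θ p s a (κs * r) j ^ 2 + ‖I j‖ₑ) ≤
      eradius θ p s a r j ^ 2 * ENNReal.ofReal (taylorRate κ κs) := by
  have hD := taylorRate_nonneg hκ0 hκ κs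
  have hk : 0 < 1 - κ ^ 2 := by nlinarith
  have hDeq : taylorRate κ κs * (1 - κ ^ 2) = κs ^ 2 + κ ^ 2 := div_mul_cancel₀ _ hk.ne'
  have hR := radius_pos (θ := θ) (p := p) (s := s) (a := a) hr j
  have hR' : radius θ p s a (κs * r) j = κs * radius θ p s a r j := mul_div_assoc _ _ _
  have hIj := hI j
  rw [← ofReal_norm (I j), Real.norm_of_nonneg hIj, eradius, eradius,
    ← ENNReal.ofReal_pow hR.le, ← ENNReal.ofReal_pow (radius_pos (mul_pos hκs hr) j).le,
    ← ENNReal.ofReal_mul hIj, ← ENNReal.ofReal_add (by positivity) hIj,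
    ← ENNReal.ofReal_add (by positivity) (by positivity), ← ENNReal.ofReal_mul (by positivity)]
  refine ENNReal.ofReal_le_ofReal ?_
  rw [hR', mul_pow]
  set R := radius θ p s a r j
  calc I j * taylorRate κ κs + (κs ^ 2 * R ^ 2 + I j)
      = I j * (taylorRate κ κs + 1) + κs ^ 2 * R ^ 2 := by ring
    _ ≤ κ ^ 2 * R ^ 2 * (taylorRate κ κs + 1) + κs ^ 2 * R ^ 2 := by gcongr; exact hIr j
    _ = R ^ 2 * (κ ^ 2 * taylorRate κ κs + (κs ^ 2 + κ ^ 2)) := by ring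
    _ = R ^ 2 * taylorRate κ κs := by rw [← hDeq]; ring

/-- The rate is dominated by the one of the norm estimate, since `x / (1 - x) ≤ 1 / log (1 / x)`
and `x / (1 - x) ≤ 2 x` for `x ≤ 1 / 2`. -/
theorem taylorRate_le_cConst (hκ0 : 0 ≤ κ) {κs : ℝ} (hκs0 : 0 < κs) (hκκs : κ ≤ κs)
    (hκs1 : κs < 1) : taylorRate κ κs ≤ (κ ^ 2 + κs ^ 2) / κs ^ 2 * cConst κs := by
  have hx : 0 < κs ^ 2 := by positivity
  have hx1 : κs ^ 2 < 1 := by nlinarith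
  have hle : κ ^ 2 ≤ κs ^ 2 := pow_le_pow_left₀ hκ0 hκκs 2
  have h1 : κs ^ 2 / (1 - κs ^ 2) ≤ cConst κs := by
    rw [cConst]
    split_ifs with h
    · have e : κs ^ (-2 : ℤ) = (κs ^ 2)⁻¹ := by rw [zpow_neg]; norm_cast
      have hlog : 0 < Real.log (κs ^ 2)⁻¹ := Real.log_pos ((one_lt_inv₀ hx).mpr hx1)
      have hlog' := Real.log_le_sub_one_of_pos (inv_pos.mpr hx)
      rw [e, div_le_div_iff₀ (by linarith) hlog, one_mul]
      calc _ ≤ κs ^ 2 * ((κs ^ 2)⁻¹ - 1) := by gcongr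
        _ = 1 - κs ^ 2 := by field_simp
    · rw [div_le_iff₀ (by linarith)]
      nlinarith
  calc taylorRate κ κs ≤ (κs ^ 2 + κ ^ 2) / (1 - κs ^ 2) := by
        unfold taylorRate
        gcongr
    _ = (κ ^ 2 + κs ^ 2) / κs ^ 2 * (κs ^ 2 / (1 - κs ^ 2)) := by
        field_simp
        ring
    _ ≤ _ := by gcongr

theorem enorm_action_le (hI : ∀ j, 0 ≤ I j) (hIr : ∀ j, I j ≤ κ ^ 2 * radius θ p s a r j ^ 2)
    (hκ0 : 0 ≤ κ) (hκ : κ < 1) (hr : 0 < r) (j : ℤ) : ‖I j‖ₑ ≤ eradius θ p s a r j ^ 2 := by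
  have hR := radius_pos (θ := θ) (p := p) (s := s) (a := a) hr j
  rw [← ofReal_norm (I j), Real.norm_of_nonneg (hI j), eradius, ← ENNReal.ofReal_pow hR.le]
  refine ENNReal.ofReal_le_ofReal ((hIr j).trans ?_)
  have : κ ^ 2 ≤ 1 := pow_le_one₀ hκ0 hκ.le
  nlinarith [sq_nonneg (radius θ p s a r j)]

/-- The projection of degree `i` replaces `|u|^{2m}` by the Taylor part of degree `i` of `X^m` at
the torus, evaluated at `|u|²`. -/
theorem proj_eq_subst (hr : 0 < r) (hI : ∀ j, 0 ≤ I j)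
    (hsqrtI : ∀ j, sqrtI j = ((√(I j) : ℝ) : ℂ)) (hIκ : ‖sqrtI‖ ≤ κ * r)
    (hIr : ∀ j, I j ≤ κ ^ 2 * radius θ p s a r j ^ 2) (hκ0 : 0 ≤ κ) (hκ : κ < 1) {H : Ser}
    (hH : majSum θ p s a r (fun _ => 1) H ≠ ∞) {u : W θ p s a} (hu : ‖u‖ ≤ r) (i : ℕ) :
    proj i H (absSq sqrtI) u = H.subst
      (fun m => MvPolynomial.aeval (fun j => ((‖u j‖ ^ 2 : ℝ) : ℂ)) (taylorPart I i m)) u := by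
  set w : ℤ → ℂ := fun j => ((‖u j‖ ^ 2 : ℝ) : ℂ) with hw
  have hu' : ∀ j, ‖u j‖ₑ ≤ eradius θ p s a r j := fun j => W.enorm_apply_le_eradius hu j
  have hcond := taylorRate_condition (θ := θ) (p := p) (s := s) (a := a) hI hIr hκ0 hκ one_pos hr
  rw [one_mul] at hcond
  have hP := polyNorm_taylorPart_le (enorm_action_le hI hIr hκ0 hκ hr) hcond
  set D := taylorRate κ 1
  have hD : 0 ≤ D := taylorRate_nonneg hκ0 hκ 1
  have hmem : absSq sqrtI ∈ Metric.ball (0 : W θ (2 * p) (2 * s) (2 * a)) (r ^ 2) := by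
    rw [mem_ball_zero_iff]
    refine (norm_absSq_le hIκ).trans_lt ?_
    rw [mul_pow]
    have h1 : κ ^ 2 < 1 := by nlinarith
    have h2 : 0 < r ^ 2 := by positivity
    nlinarith
  have hline : ∀ t : ℂ, H.lift u
      (absSq sqrtI + t • (absSq u - absSq sqrtI) : W θ (2 * p) (2 * s) (2 * a)) =
      H.subst (fun m => mpow (fun j => (I j : ℂ) + t * (w j - I j)) m) u := by
    intro t
    have hseq : ∀ j, (absSq sqrtI + t • (absSq u - absSq sqrtI)) j =
        (I j : ℂ) + t * (w j - I j) := by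
      intro j
      have h1 : absSq sqrtI j = (I j : ℂ) := by
        change ((‖sqrtI j‖ ^ 2 : ℝ) : ℂ) = _
        rw [hsqrtI, Complex.norm_real, Real.norm_of_nonneg (Real.sqrt_nonneg _),
          Real.sq_sqrt (hI j)]
      have h2 : (absSq u - absSq sqrtI) j = absSq u j - absSq sqrtI j := rfl
      rw [W.add_apply, W.smul_apply, h2, h1]
      rfl
    rw [← funext hseq]
    rfl
  rw [proj, iteratedFDeriv_eq_of_hasSum_line (analyticOnNhd_lift hr hH hu' _ hmem)
    (c := fun n => H.subst (fun m => MvPolynomial.aeval w (taylorPart I n m)) u) ?_ i]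
  · rw [← mul_assoc, one_div_mul_cancel (by exact_mod_cast i.factorial_ne_zero), one_mul]
  -- the radius of convergence in `t` is at least `1 / D`
  have hball : Metric.ball (0 : ℂ) (1 / (D + 1)) ∈ nhds (0 : ℂ) :=
    Metric.ball_mem_nhds _ (by positivity)
  filter_upwards [hball] with t ht
  rw [mem_ball_zero_iff, lt_div_iff₀ (by positivity)] at ht
  have htD : ‖t‖ * D < 1 := by nlinarith [norm_nonneg t]
  have htD' : ‖t‖ₑ * ENNReal.ofReal D < 1 := by
    rw [← ofReal_norm, ← ENNReal.ofReal_mul (norm_nonneg t)]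
    exact ENNReal.ofReal_lt_one.mpr htD
  rw [hline]
  simp only [← subst_const_mul]
  refine hasSum_subst (K := (1 - ‖t‖ₑ * ENNReal.ofReal D)⁻¹) ?_ hH hu' (fun m => ?_)
    (fun m => hasSum_mpow_line I w t m)
  · exact ENNReal.inv_ne_top.mpr (tsub_pos_of_lt htD').ne'
  · rw [← ENNReal.tsum_geometric, ← ENNReal.tsum_mul_right]
    refine ENNReal.tsum_le_tsum fun n => ?_
    rw [enorm_mul, enorm_pow]
    calc _ ≤ ‖t‖ₑ ^ n * (epow (fun j => eradius θ p s a r j ^ 2) m * ENNReal.ofReal D ^ n) := by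
          gcongr
          exact (enorm_aeval_le (enorm_sq_le hu') _).trans (hP n m)
      _ = _ := by rw [mul_pow]; ring

theorem tail_eq_subst (hr : 0 < r) (hI : ∀ j, 0 ≤ I j)
    (hsqrtI : ∀ j, sqrtI j = ((√(I j) : ℝ) : ℂ)) (hIκ : ‖sqrtI‖ ≤ κ * r)
    (hIr : ∀ j, I j ≤ κ ^ 2 * radius θ p s a r j ^ 2) (hκ0 : 0 ≤ κ) (hκ : κ < 1) {H : Ser}
    (hH : majSum θ p s a r (fun _ => 1) H ≠ ∞) {u : W θ p s a} (hu : ‖u‖ ≤ r) (q : ℕ) :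
    tail q H (absSq sqrtI) u = H.subst
      (fun m => MvPolynomial.aeval (fun j => ((‖u j‖ ^ 2 : ℝ) : ℂ)) (taylorTail I q m)) u := by
  set w : ℤ → ℂ := fun j => ((‖u j‖ ^ 2 : ℝ) : ℂ) with hw
  have hu' : ∀ j, ‖u j‖ₑ ≤ eradius θ p s a r j := fun j => W.enorm_apply_le_eradius hu j
  have hcond := taylorRate_condition (θ := θ) (p := p) (s := s) (a := a) hI hIr hκ0 hκ one_pos hr
  rw [one_mul] at hcond
  have hP := polyNorm_taylorPart_le (enorm_action_le hI hIr hκ0 hκ hr) hcond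
  rw [tail, eval_eq_subst]
  simp only [proj_eq_subst hr hI hsqrtI hIκ hIr hκ0 hκ hH hu]
  have h0 := summable_subst (B := mpow w) ENNReal.one_ne_top hH hu' fun m => by
    rw [enorm_mpow, one_mul]
    exact epow_mono (enorm_sq_le hu') m
  have h1 := fun i => summable_subst (B := fun m => MvPolynomial.aeval w (taylorPart I i m))
    (ENNReal.pow_ne_top (n := i) ENNReal.ofReal_ne_top) hH hu' fun m => by
      rw [mul_comm]
      exact (enorm_aeval_le (enorm_sq_le hu') _).trans (hP i m)
  simp only [Ser.subst]
  rw [← Summable.tsum_finsetSum fun i _ => h1 i, ← h0.tsum_sub (summable_sum fun i _ => h1 i)]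
  refine tsum_congr fun x => ?_
  have hm : MvPolynomial.aeval w (MvPolynomial.monomial (x.1 ⊓ x.2) (1 : ℝ)) =
      mpow w (x.1 ⊓ x.2) := by
    rw [MvPolynomial.aeval_monomial, map_one, one_mul]
    rfl
  rw [taylorTail, map_sub, map_sum, hm, ← Finset.mul_sum, ← Finset.sum_mul]
  ring

end Torus

/-! ### The sum over the quotients -/

/-- A homogeneous polynomial in `Y` of degree `q`, evaluated at `Y = w - I`, as a sum over the
multi-indices of degree `q`. -/
theorem hasSum_aeval_eval {Q : MvPolynomial ℤ (MvPolynomial ℤ ℝ)} {q : ℕ} (hQ : Q.IsHomogeneous q)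
    (I : ℤ → ℝ) (w : ℤ → ℂ) :
    HasSum (fun δ : {δ : MI // δ.degree = q} =>
        mpow (fun j => w j - I j) δ * MvPolynomial.aeval w (Q.coeff δ.1))
      (MvPolynomial.aeval w
        (MvPolynomial.eval (fun j => MvPolynomial.X j - MvPolynomial.C (I j)) Q)) := by
  have h1 : HasSum (fun δ : MI => mpow (fun j => w j - I j) δ * MvPolynomial.aeval w (Q.coeff δ))
      (MvPolynomial.aeval w
        (MvPolynomial.eval (fun j => MvPolynomial.X j - MvPolynomial.C (I j)) Q)) := by
    have e : MvPolynomial.aeval w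
        (MvPolynomial.eval (fun j => MvPolynomial.X j - MvPolynomial.C (I j)) Q) =
        ∑ δ ∈ Q.support, mpow (fun j => w j - I j) δ * MvPolynomial.aeval w (Q.coeff δ) := by
      rw [MvPolynomial.eval_eq, map_sum]
      refine Finset.sum_congr rfl fun δ _ => ?_
      rw [map_mul, mul_comm, map_prod]
      simp [mpow, Finsupp.prod]
    rw [e]
    refine hasSum_sum_of_ne_finset_zero fun δ hδ => ?_
    rw [MvPolynomial.notMem_support_iff.mp hδ, map_zero, mul_zero]
  refine (hasSum_subtype_iff_of_support_subset (s := {δ : MI | δ.degree = q}) fun δ hδ => ?_).mpr h1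
  by_contra h
  refine hδ ?_
  simp only
  rw [hQ.coeff_eq_zero h, map_zero, mul_zero]

theorem totallyConvergent_of_majSum {ρ r : ℝ} (hρr : ρ ≤ r) {G : Ser}
    (hG : majSum θ p s a r (fun _ => 1) G ≠ ∞) : TotallyConvergent θ p s a ρ G := by
  refine ⟨_, ENNReal.summable_toReal hG, fun x u hu => ?_⟩
  have hfin : ‖G x.1 x.2‖ₑ * (1 * emono θ p s a r x) ≠ ∞ :=
    ENNReal.mul_ne_top enorm_ne_top (ENNReal.mul_ne_top ENNReal.one_ne_top (emono_ne_top x))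
  have h : ‖G x.1 x.2 * mono u x.1 x.2‖ₑ ≤ ‖G x.1 x.2‖ₑ * (1 * emono θ p s a r x) := by
    rw [enorm_mul, one_mul]
    exact mul_le_mul_right (enorm_mono_le (fun j => W.enorm_apply_le_eradius (hu.trans hρr) j) x) _
  have h2 := ENNReal.toReal_mono hfin h
  rwa [toReal_enorm] at h2

end NLSTorus

end

theorem mainTheorem6
    {θ p s a r η : ℝ} (hθ0 : 0 < θ) (hθ1 : θ < 1) (hp : 1 < p) (hs : 0 < s) (ha : 0 ≤ a)
    (hr : 0 < r) (hη : 0 ≤ η)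
    -- the set of frequencies, the torus and the family of Hamiltonians
    (O : Set (ℤ → ℝ)) (hO : O ⊆ NLSTorus.freqCube)
    (I : ℤ → ℝ) (hI : ∀ j, 0 ≤ I j) (sqrtI : NLSTorus.W θ p s a)
    (hsqrtI : ∀ j, sqrtI j = ((√(I j) : ℝ) : ℂ))
    (κ : ℝ) (hκ : κ < 1) (hIκ : ‖sqrtI‖ ≤ κ * r)
    (H : (ℤ → ℝ) → NLSTorus.Ser) (hH : NLSTorus.IsRegularFamily θ p s a r η O H) (q : ℕ) :
    -- the Taylor expansion at the origin of the tail of degree at least `2q - 2`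
    ∃ T : (ℤ → ℝ) → NLSTorus.Ser,
      NLSTorus.IsRegularFamily θ p s a r η O T ∧
      (∀ ω ∈ O, ∀ u : NLSTorus.W θ p s a, ‖u‖ < r →
        (T ω).eval u = NLSTorus.tail q (H ω) (NLSTorus.absSq sqrtI) u) ∧
      -- the representation formula
      (∃ G : (ℤ → ℝ) → NLSTorus.MI → NLSTorus.Ser, ∀ ω ∈ O,
        (∀ u : NLSTorus.W θ p s a, ‖u‖ < r →
          HasSum (fun δ : {δ : NLSTorus.MI // δ.degree = q} =>
            NLSTorus.mpow (fun j => ((‖u j‖ ^ 2 - I j : ℝ) : ℂ)) δ * (G ω δ).eval u)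
            (NLSTorus.tail q (H ω) (NLSTorus.absSq sqrtI) u)) ∧
        ∀ δ : NLSTorus.MI, δ.degree = q →
          AnalyticOnNhd ℝ (fun u : NLSTorus.W θ p s a => (G ω δ).eval u) (Metric.ball 0 r) ∧
          ∀ κs : ℝ, 0 < κs → κs < 1 →
            NLSTorus.TotallyConvergent θ p s a (κs * r) (G ω δ)) ∧
      -- the norm estimate
      ∀ κs : ℝ, 0 < κs → κ ≤ κs → κs < 1 → ∀ μ : ℝ≥0,
        NLSTorus.famNorm θ p s a (κs * r) η μ O T ≤
          ENNReal.ofReal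
            (1 / κs ^ 2 * ((κ ^ 2 + κs ^ 2) / κs ^ 2 * NLSTorus.cConst κs) ^ q) *
            NLSTorus.famNorm θ p s a r η μ O H := by
  have hκ0 : 0 ≤ κ := by
    by_contra h
    have := (norm_nonneg sqrtI).trans hIκ
    nlinarith
  have hIr := NLSTorus.action_le hI hsqrtI hIκ
  have hcond : ∀ {κs : ℝ}, 0 < κs → _ := fun {κs} h =>
    NLSTorus.taylorRate_condition (θ := θ) (p := p) (s := s) (a := a) hI hIr hκ0 hκ h hr
  -- the qualitative statements use the full ball, that is, the case `κs = 1`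
  have hcond1 := hcond one_pos
  rw [one_mul] at hcond1
  have hle : ∀ m l, (NLSTorus.taylorTail I q m).coeff l ≠ 0 → l ≤ m := fun m l =>
    NLSTorus.le_of_coeff_taylorTail_ne_zero I
  have hDtop : ∀ κs, ENNReal.ofReal (NLSTorus.taylorRate κ κs) ^ q ≠ ∞ := fun κs =>
    ENNReal.pow_ne_top ENNReal.ofReal_ne_top
  have hA : ∀ κs : ℝ, 0 < κs → κs ≤ 1 → ∀ m,
      NLSTorus.polyNorm (fun j => NLSTorus.eradius θ p s a (κs * r) j ^ 2)
        (NLSTorus.taylorTail I q m) ≤ ENNReal.ofReal (NLSTorus.taylorRate κ κs) ^ q *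
          NLSTorus.epow (fun j => NLSTorus.eradius θ p s a r j ^ 2) m := fun κs h0 h1 m => by
    rw [mul_comm (_ ^ q)]
    refine NLSTorus.polyNorm_taylorTail_le (fun j => ?_) (hcond h0) q m
    refine pow_le_pow_left' (ENNReal.ofReal_le_ofReal ?_) 2
    exact div_le_div_of_nonneg_right (by nlinarith) (NLSTorus.weight_pos θ p s a j).le
  have hA1 := hA 1 one_pos le_rfl
  rw [one_mul] at hA1
  have hmaj : ∀ ω ∈ O, NLSTorus.majSum θ p s a r (fun _ => 1) (H ω) ≠ ∞ := fun ω hω =>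
    NLSTorus.majSum_ne_top_of_isMajorantAnalytic hp hs ha hr (hH.regular ω hω).analytic
  have htail : ∀ ω ∈ O, ∀ u : NLSTorus.W θ p s a, ‖u‖ < r →
      NLSTorus.tail q (H ω) (NLSTorus.absSq sqrtI) u = _ := fun ω hω u hu =>
    NLSTorus.tail_eq_subst hr hI hsqrtI hIκ hIr hκ0 hκ (hmaj ω hω) hu.le q
  refine ⟨fun ω => (H ω).transform (NLSTorus.taylorTail I q),
    NLSTorus.isRegularFamily_transform hp hs ha hη hr (hDtop 1) hle hA1 hH,
    fun ω hω u hu => ?_, ?_, fun κs h0 hκκs h1 μ => ?_⟩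
  · rw [htail ω hω u hu]
    exact NLSTorus.eval_transform (hDtop 1) (hmaj ω hω) hA1
      fun j => NLSTorus.W.enorm_apply_le_eradius hu.le j
  · choose Q hQhom hQeval hQnorm using NLSTorus.exists_taylorQuotient I
    set V : ℤ → ℝ≥0∞ := fun j => NLSTorus.eradius θ p s a r j ^ 2 + ‖I j‖ₑ with hV
    have hQ := fun m => hQnorm m (fun j => NLSTorus.eradius θ p s a r j ^ 2) V _ _
      (fun j => le_rfl) hcond1 q
    have hV0 : ∀ δ, NLSTorus.epow V δ ≠ 0 := NLSTorus.epow_ne_zero fun j h =>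
      pow_ne_zero 2 (NLSTorus.eradius_ne_zero hr j) (add_eq_zero.mp h).1
    have hVt : ∀ δ, NLSTorus.epow V δ ≠ ∞ := NLSTorus.epow_ne_top fun j =>
      ENNReal.add_ne_top.mpr ⟨ENNReal.pow_ne_top (NLSTorus.eradius_ne_top j), enorm_ne_top⟩
    have hK : ∀ δ, ENNReal.ofReal (NLSTorus.taylorRate κ 1) ^ q / NLSTorus.epow V δ ≠ ∞ :=
      fun δ => ENNReal.div_ne_top (hDtop 1) (hV0 δ)
    -- isolating the coefficient of `Y^δ` divides the bound by `V^δ`, where `V` bounds `||u|² - I|`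
    have hAQ : ∀ δ : NLSTorus.MI, ∀ m,
        NLSTorus.polyNorm (fun j => NLSTorus.eradius θ p s a r j ^ 2) ((Q m q).coeff δ) ≤
          ENNReal.ofReal (NLSTorus.taylorRate κ 1) ^ q / NLSTorus.epow V δ *
            NLSTorus.epow (fun j => NLSTorus.eradius θ p s a r j ^ 2) m := fun δ m => by
      rw [← ENNReal.mul_div_right_comm, ENNReal.le_div_iff_mul_le (Or.inl (hV0 δ))
        (Or.inl (hVt δ)), mul_comm (_ ^ q)]
      exact (NLSTorus.mul_epow_le_wsum (Q m q) δ).trans (hQ m)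
    refine ⟨fun ω δ => (H ω).transform fun m => (Q m q).coeff δ, fun ω hω =>
      ⟨fun u hu => ?_, fun δ hδ => ?_⟩⟩
    · have hu' : ∀ j, ‖u j‖ₑ ≤ NLSTorus.eradius θ p s a r j := fun j =>
        NLSTorus.W.enorm_apply_le_eradius hu.le j
      rw [htail ω hω u hu]
      simp only [NLSTorus.eval_transform (hK _) (hmaj ω hω) (hAQ _) hu',
        ← NLSTorus.subst_const_mul]
      refine NLSTorus.hasSum_subst (hDtop 1) (hmaj ω hω) hu' (fun m => ?_) fun m => ?_
      · rw [mul_comm (_ ^ q)]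
        refine le_trans ?_ (hQ m)
        refine le_trans ?_ (ENNReal.tsum_comp_le_tsum_of_injective
          (Subtype.val_injective (p := fun δ : NLSTorus.MI => δ.degree = q)) _)
        refine ENNReal.tsum_le_tsum fun δ => ?_
        rw [enorm_mul, mul_comm, NLSTorus.enorm_mpow]
        refine mul_le_mul' (NLSTorus.enorm_aeval_le (NLSTorus.enorm_sq_le hu') _)
          (NLSTorus.epow_mono (fun j => ?_) _)
        rw [Complex.ofReal_sub]
        refine enorm_sub_le.trans (add_le_add (NLSTorus.enorm_sq_le hu' j) ?_)
        rw [NLSTorus.enorm_ofReal_complex]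
      · rw [← hQeval m q]
        simpa only [Complex.ofReal_sub] using NLSTorus.hasSum_aeval_eval (hQhom m q) I
          fun j => ((‖u j‖ ^ 2 : ℝ) : ℂ)
    · have hG : NLSTorus.majSum θ p s a r (fun _ => 1)
          ((H ω).transform fun m => (Q m q).coeff δ) ≠ ∞ :=
        ne_top_of_le_ne_top (ENNReal.mul_ne_top (hK δ) (hmaj ω hω))
          (NLSTorus.majSum_transform_le le_rfl (fun _ _ _ _ _ => le_rfl) (hAQ δ) _)
      exact ⟨NLSTorus.analyticOnNhd_eval hr hG, fun κs _ h1 =>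
        NLSTorus.totallyConvergent_of_majSum (by nlinarith) hG⟩
  · have hκr : 0 < κs * r := mul_pos h0 hr
    refine (NLSTorus.famNorm_transform_le hp hs ha hη hκr hr (by nlinarith) (hDtop κs) hle
      (hA κs h0 h1.le) hH μ).trans (mul_le_mul_left ?_ _)
    have hD := NLSTorus.taylorRate_nonneg hκ0 hκ κs
    rw [← ENNReal.ofReal_pow hD, ← ENNReal.ofReal_mul (by positivity)]
    refine ENNReal.ofReal_le_ofReal ?_
    have e : (r / (κs * r)) ^ 2 = 1 / κs ^ 2 := by field_simp
    rw [e]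
    gcongr
    exact NLSTorus.taylorRate_le_cConst hκ0 h0 hκκs h1
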